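/- Let $X$ be a locally compact second countable Hausdorff space, $U\subseteq X$ an open subset and $\varphi:U\to X$ a local homeomorphism. Put $D(\varphi^0)=X$, $\varphi^0=\mathrm{id}_X$ and, for $n\ge 1$, $D(\varphi^n)=U\cap\varphi^{-1}(U)\cap\dots\cap\varphi^{-(n-1)}(U)$, the domain of $\varphi^n$. Let $$\mathcal G_\varphi=\{(x,n-m,y)\in X\times\mathbb Z\times X:\ x\in D(\varphi^n),\ y\in D(\varphi^m),\ \varphi^n(x)=\varphi^m(y)\},$$ with product $(x,k,y)(y,l,z)=(x,k+l,z)$ and inverse $(x,k,y)^{-1}=(y,-k,x)$, and with the topology having as a basis the sets $\{(x,n-m,y):\varphi^n(x)=\varphi^m(y),\ x\in W,\ y\in V\}$, where $W\subseteq D(\varphi^n)$ and $V\subseteq D(\varphi^m)$ are open; the unit space is identified with $X$ through $x\mapsto (x,0,x)$. Let $C^*_r(\mathcal G_\varphi)$ be its reduced groupoid $C^*$-algebra, the completion of the convolution algebra $C_c(\mathcal G_\varphi)$ in the norm $\sup_{x\in X}\|\pi_x(f)\|$, where $\pi_x$ is the left regular representation on $\ell^2(s^{-1}(x))$. Let $P:C^*_r(\mathcal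 G_\varphi)\to C_0(X)$ be the conditional expectation extending the restriction of functions from $\mathcal G_\varphi$ to $X$. Assume that $\varphi$ is minimal, i.e. for every $x\in X$ the set $\{y\in X:\ \exists n,m\ge 0,\ x\in D(\varphi^n),\ y\in D(\varphi^m),\ \varphi^m(y)=\varphi^n(x)\}$ is dense in $X$, and that $\varphi$ has at least one aperiodic point, i.e. a point $x$ such that $x\in D(\varphi^n)\cap D(\varphi^m)$ and $\varphi^n(x)=\varphi^m(x)$ imply $n=m$. Let $\alpha=(\alpha_t)_{t\in\mathbb R}$ be a (pointwise norm) continuous one-parameter group of $*$-automorphisms of $A=C^*_r(\mathcal G_\varphi)$. A proper weight on $A$ is a map $\psi:A_+\to[0,\infty]$ that is additive and positively homogeneous, non-zero, densely defined and lower semi-continuous. Put $\mathcal N_\psi=\{a\in A:\psi(a^*a)<\infty\}$ and $\mathcal M_\psi=\mathrm{span}\{a^*b:a,b\in\mathcal N_\psi\}$, and denote also by $\psi$ its unique linear extension to $\mathcal M_\psi$. A proper weight $\psi$ is a $\beta$-KMS weight for $\alpha$ when $\psi\circ\alpha_t=\psi$ for all $t\in\mathbb R$ and, for all $a,b\in\mathcal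 N_\psi\cap\mathcal N_\psi^*$, there is a bounded continuous function $f$ on the closed strip of complex numbers with imaginary part between $0$ and $\beta$, holomorphic in its interior, with $f(t)=\psi(a\alpha_t(b))$ and $f(t+i\beta)=\psi(\alpha_t(b)a)$ for all $t\in\mathbb R$. It is diagonal when there is a regular Borel measure $m$ on $X$ (finite on compact sets) with $\psi(a)=\int_X P(a)\,dm$ for all $a\in A_+$. If for some real $\beta\neq 0$ there is a diagonal $\beta$-KMS weight for $\alpha$, then there is a continuous function $F:U\to\mathbb R$ such that, for all $t\in\mathbb R$ and $g\in C_c(\mathcal G_\varphi)$, the element $\alpha_t(g)$ lies in $C_c(\mathcal G_\varphi)$ and $$\alpha_t(g)(\xi)=e^{itc_F(\xi)}g(\xi)\qquad\text{for all }\xi\in\mathcal G_\varphi,$$ where $c_F(x,n-m,y)=\sum_{i=0}^{n-1}F(\varphi^i(x))-\sum_{i=0}^{m-1}F(\varphi^i(y))$ whenever $x\in D(\varphi^n)$, $y\in D(\varphi^m)$ and $\varphi^n(x)=\varphi^m(y)$; that is, $\alpha=\sigma^{c_F}$. -/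

import Mathlib

open Set Filter Topology MeasureTheory
open scoped ENNReal NNReal CompactlySupported lp

noncomputable section

/-! ## Weights and KMS weights on a C*-algebra -/

namespace KMS

variable {A : Type*} [NonUnitalCStarAlgebra A]

/-- A continuous (i.e. pointwise norm continuous) one-parameter group of `*`-automorphisms. -/
structure OneParameterGroup (A : Type*) [NonUnitalCStarAlgebra A] where
  toFun : ℝ → (A ≃⋆ₐ[ℂ] A)
  map_add : ∀ s t : ℝ, ∀ a : A, toFun (s + t) a = toFun s (toFun t a)
  continuous : ∀ a : A, Continuous fun t : ℝ => toFun t a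

/-- The closed strip of complex numbers whose imaginary part lies between `0` and `β`
(`β` may be negative). -/
def strip (β : ℝ) : Set ℂ := {z | z.im ∈ Set.uIcc 0 β}

/-- `{a | ψ (a* a) < ∞}`. -/
def leftIdeal (ψ : A → ℝ≥0∞) : Set A := {a | ψ (star a * a) < ∞}

/-- The linear span of `{a* b | ψ (a* a) < ∞, ψ (b* b) < ∞}`. -/
def definitionSpace (ψ : A → ℝ≥0∞) : Submodule ℂ A :=
  Submodule.span ℂ {c | ∃ a ∈ leftIdeal ψ, ∃ b ∈ leftIdeal ψ, c = star a * b}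

variable [PartialOrder A] [StarOrderedRing A]

/-- A weight is a map `A₊ → [0, ∞]`; it is represented here by a function on `A` of which only the
values at positive elements are ever used. -/
structure IsWeight (ψ : A → ℝ≥0∞) : Prop where
  add : ∀ a b : A, 0 ≤ a → 0 ≤ b → ψ (a + b) = ψ a + ψ b
  smul : ∀ (r : ℝ) (a : A), 0 < r → 0 ≤ a → ψ ((r : ℂ) • a) = ENNReal.ofReal r * ψ a

/-- A weight is proper when it is non-zero, densely defined and lower semi-continuous. -/
structure IsProperWeight (ψ : A → ℝ≥0∞) : Prop extends IsWeight ψ where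
  ne_zero : ∃ a : A, 0 ≤ a ∧ ψ a ≠ 0
  denselyDefined : {a : A | 0 ≤ a} ⊆ closure {a : A | 0 ≤ a ∧ ψ a < ∞}
  lowerSemicontinuous : ∀ r : ℝ≥0, IsClosed {a : A | 0 ≤ a ∧ ψ a ≤ r}

/-- `L` is the (unique) linear functional on the definition space that extends the weight `ψ`. -/
def IsLinearExtension (ψ : A → ℝ≥0∞) (L : definitionSpace ψ →ₗ[ℂ] ℂ) : Prop :=
  ∀ c : definitionSpace ψ, 0 ≤ (c : A) → ψ c < ∞ ∧ L c = ((ψ c).toReal : ℂ)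

/-- `ψ` is a `β`-KMS weight for `α`. In the last field `L` is the linear functional
on the definition space which extends `ψ`. -/
structure IsKMSWeight (α : OneParameterGroup A) (β : ℝ) (ψ : A → ℝ≥0∞) : Prop
    extends IsProperWeight ψ where
  invariant : ∀ (t : ℝ) (a : A), 0 ≤ a → ψ (α.toFun t a) = ψ a
  kms : ∃ L : definitionSpace ψ →ₗ[ℂ] ℂ, IsLinearExtension ψ L ∧
    ∀ a b : A, a ∈ leftIdeal ψ → star a ∈ leftIdeal ψ → b ∈ leftIdeal ψ → star b ∈ leftIdeal ψ →
      ∃ F : ℂ → ℂ, ContinuousOn F (strip β) ∧ (∃ C : ℝ, ∀ z ∈ strip β, ‖F z‖ ≤ C) ∧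
        DifferentiableOn ℂ F (interior (strip β)) ∧
        ∀ t : ℝ, (∃ h : a * α.toFun t b ∈ definitionSpace ψ, F t = L ⟨_, h⟩) ∧
          ∃ h : α.toFun t b * a ∈ definitionSpace ψ, F (t + β * Complex.I) = L ⟨_, h⟩

end KMS

/-! ## Locally defined local homeomorphisms and their groupoids -/

/-- A local homeomorphism `φ : U → X` on an open subset `U` of `X`. The map is represented by
a function on `X` whose values outside `U = dom` are irrelevant. -/
structure PartialLocalHomeo (X : Type*) [TopologicalSpace X] where
  toFun : X → X
  dom : Set X
  isOpen_dom : IsOpen dom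
  isLocalHomeomorphOn : IsLocalHomeomorphOn toFun dom

namespace PartialLocalHomeo

variable {X : Type*} [TopologicalSpace X] (φ : PartialLocalHomeo X)

/-- The domain `D(φⁿ) = U ∩ φ⁻¹(U) ∩ ⋯ ∩ φ⁻⁽ⁿ⁻¹⁾(U)` of the `n`-th iterate; `D(φ⁰) = X`. -/
def iterDom (n : ℕ) : Set X := {x | ∀ i < n, φ.toFun^[i] x ∈ φ.dom}

/-- `x` is aperiodic: `φⁿ(x) = φᵐ(x)`, both sides being defined, only if `n = m`. -/
def IsAperiodic (x : X) : Prop :=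
  ∀ n m : ℕ, x ∈ φ.iterDom n → x ∈ φ.iterDom m → φ.toFun^[n] x = φ.toFun^[m] x → n = m

/-- The union over `n, m` of the sets `φ⁻ᵐ(φⁿ(x))`. -/
def orbit (x : X) : Set X :=
  {y | ∃ n m : ℕ, x ∈ φ.iterDom n ∧ y ∈ φ.iterDom m ∧ φ.toFun^[m] y = φ.toFun^[n] x}

def IsMinimal : Prop := ∀ x : X, Dense (φ.orbit x)

/-- `Rel n m x y`: both `φⁿ(x)` and `φᵐ(y)` are defined, and they agree. -/
def Rel (n m : ℕ) (x y : X) : Prop :=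
  x ∈ φ.iterDom n ∧ y ∈ φ.iterDom m ∧ φ.toFun^[n] x = φ.toFun^[m] y

/-- The groupoid of `φ`: triples `(x, n - m, y)` with `φⁿ(x) = φᵐ(y)`. -/
@[ext]
structure Gpd where
  rng : X
  deg : ℤ
  src : X
  exists_rel : ∃ n m : ℕ, deg = (n : ℤ) - m ∧ φ.Rel n m rng src

variable {φ}

theorem Rel.symm {n m : ℕ} {x y : X} (h : φ.Rel n m x y) : φ.Rel m n y x :=
  ⟨h.2.1, h.1, h.2.2.symm⟩

theorem mem_iterDom_add {n j : ℕ} {x : X} :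
    x ∈ φ.iterDom (n + j) ↔ x ∈ φ.iterDom n ∧ φ.toFun^[n] x ∈ φ.iterDom j := by
  constructor
  · intro h
    refine ⟨fun i hi => h i (by omega), fun i hi => ?_⟩
    rw [← Function.iterate_add_apply]
    exact h _ (by omega)
  · rintro ⟨h1, h2⟩ i hi
    by_cases hin : i < n
    · exact h1 i hin
    · have := h2 (i - n) (by omega)
      rwa [← Function.iterate_add_apply, Nat.sub_add_cancel (by omega)] at this

theorem Rel.add {n m j : ℕ} {x y : X} (h : φ.Rel n m x y) (hy : y ∈ φ.iterDom (m + j)) :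
    φ.Rel (n + j) (m + j) x y := by
  have hy' := mem_iterDom_add.1 hy
  refine ⟨mem_iterDom_add.2 ⟨h.1, by rw [h.2.2]; exact hy'.2⟩, hy, ?_⟩
  rw [Nat.add_comm n j, Nat.add_comm m j, Function.iterate_add_apply, Function.iterate_add_apply,
    h.2.2]

theorem Rel.trans {n m p q : ℕ} {x y z : X} (h : φ.Rel n m x y) (h' : φ.Rel p q y z) :
    ∃ n' q' : ℕ, (n' : ℤ) - q' = ((n : ℤ) - m) + (p - q) ∧ φ.Rel n' q' x z := by
  rcases le_total m p with hmp | hmp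
  · obtain ⟨j, rfl⟩ := Nat.exists_eq_add_of_le hmp
    have h1 := h.add h'.1
    exact ⟨n + j, q, by push_cast; ring, h1.1, h'.2.1, h1.2.2.trans h'.2.2⟩
  · obtain ⟨j, rfl⟩ := Nat.exists_eq_add_of_le hmp
    have h1 := (h'.symm.add h.2.1).symm
    exact ⟨n, q + j, by push_cast; ring, h.1, h1.2.1, h.2.2.trans h1.2.2⟩

namespace Gpd

/-- The unit `(x, 0, x)`. -/
def unit (φ : PartialLocalHomeo X) (x : X) : φ.Gpd where
  rng := x
  deg := 0
  src := x
  exists_rel := ⟨0, 0, by simp, fun i hi => by omega, fun i hi => by omega, rfl⟩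

/-- `(x, k, y)⁻¹ = (y, -k, x)`. -/
def inv (g : φ.Gpd) : φ.Gpd where
  rng := g.src
  deg := -g.deg
  src := g.rng
  exists_rel := by
    obtain ⟨n, m, h, hr⟩ := g.exists_rel
    exact ⟨m, n, by rw [h]; ring, hr.symm⟩

/-- `(x, k, y) (y, l, z) = (x, k + l, z)`. -/
def mul (g h : φ.Gpd) (hgh : g.src = h.rng) : φ.Gpd where
  rng := g.rng
  deg := g.deg + h.deg
  src := h.src
  exists_rel := by
    obtain ⟨n, m, e, hr⟩ := g.exists_rel
    obtain ⟨p, q, e', hr'⟩ := h.exists_rel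
    obtain ⟨n', q', e'', hr''⟩ := hr.trans (hgh ▸ hr')
    exact ⟨n', q', by rw [e, e', e''], hr''⟩

/-- The set `{(x, n - m, y) | φⁿ(x) = φᵐ(y), x ∈ W, y ∈ V}`. -/
def basicSet (φ : PartialLocalHomeo X) (n m : ℕ) (W V : Set X) : Set φ.Gpd :=
  {g | g.deg = (n : ℤ) - m ∧ φ.Rel n m g.rng g.src ∧ g.rng ∈ W ∧ g.src ∈ V}

instance : TopologicalSpace φ.Gpd :=
  TopologicalSpace.generateFrom
    {S | ∃ (n m : ℕ) (W V : Set X), IsOpen W ∧ W ⊆ φ.iterDom n ∧ IsOpen V ∧ V ⊆ φ.iterDom m ∧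
      S = basicSet φ n m W V}

/-- The source fibre `{g | s(g) = x}`. -/
def Fiber (φ : PartialLocalHomeo X) (x : X) : Type _ := {g : φ.Gpd // g.src = x}

/-- The unit `(x, 0, x)` as an element of the source fibre over `x`. -/
def Fiber.unit (φ : PartialLocalHomeo X) (x : X) : Fiber φ x := ⟨Gpd.unit φ x, rfl⟩

/-- `g h⁻¹` for `g` and `h` with the same source. -/
def Fiber.div {x : X} (g h : Fiber φ x) : φ.Gpd :=
  mul g.1 (inv h.1) (g.2.trans h.2.symm)

/-- The value `∑_{i < n} F(φⁱ(x)) - ∑_{i < m} F(φⁱ(y))` at `(x, n - m, y)`. Only the values of `F`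
on `U` enter. By `cocycle_eq` the choice of `n` and `m` does not matter. -/
def cocycle (F : X → ℝ) (g : φ.Gpd) : ℝ :=
  (∑ i ∈ Finset.range g.exists_rel.choose, F (φ.toFun^[i] g.rng)) -
    ∑ i ∈ Finset.range g.exists_rel.choose_spec.choose, F (φ.toFun^[i] g.src)

theorem sum_eq_of_rel (F : X → ℝ) {n m j : ℕ} {x y : X} (h : φ.Rel n m x y) :
    (∑ i ∈ Finset.range (n + j), F (φ.toFun^[i] x)) -
        ∑ i ∈ Finset.range (m + j), F (φ.toFun^[i] y) =
      (∑ i ∈ Finset.range n, F (φ.toFun^[i] x)) - ∑ i ∈ Finset.range m, F (φ.toFun^[i] y) := by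
  have e : ∀ i, φ.toFun^[n + i] x = φ.toFun^[m + i] y := fun i => by
    rw [Nat.add_comm n i, Nat.add_comm m i, Function.iterate_add_apply,
      Function.iterate_add_apply, h.2.2]
  rw [Finset.sum_range_add, Finset.sum_range_add]
  simp only [e]
  ring

theorem cocycle_eq (F : X → ℝ) (g : φ.Gpd) {n m : ℕ} (hd : g.deg = (n : ℤ) - m)
    (h : φ.Rel n m g.rng g.src) :
    cocycle F g = (∑ i ∈ Finset.range n, F (φ.toFun^[i] g.rng)) -
      ∑ i ∈ Finset.range m, F (φ.toFun^[i] g.src) := by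
  have hs := g.exists_rel.choose_spec.choose_spec
  unfold cocycle
  generalize g.exists_rel.choose_spec.choose = m' at hs
  generalize g.exists_rel.choose = n' at hs
  obtain ⟨hd', h'⟩ := hs
  rcases le_total n n' with hn | hn
  · obtain ⟨j, rfl⟩ := Nat.exists_eq_add_of_le hn
    obtain rfl : m' = m + j := by omega
    exact sum_eq_of_rel F h
  · obtain ⟨j, rfl⟩ := Nat.exists_eq_add_of_le hn
    obtain rfl : m = m' + j := by omega
    exact (sum_eq_of_rel F h').symm

/-! ### Boundedness of the regular representations on compactly supported functions -/

theorem exists_injOn_iterate (n : ℕ) : ∀ x ∈ φ.iterDom n, ∃ W : Set X, IsOpen W ∧ x ∈ W ∧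
    W ⊆ φ.iterDom n ∧ ContinuousOn φ.toFun^[n] W ∧ InjOn φ.toFun^[n] W := by
  induction n with
  | zero =>
    intro x _
    exact ⟨univ, isOpen_univ, mem_univ _, fun y _ i hi => by omega, continuousOn_id, injOn_id _⟩
  | succ n ih =>
    intro x hx
    obtain ⟨hx1, hx2⟩ := mem_iterDom_add.1 hx
    obtain ⟨W, hWo, hxW, hWD, hWc, hWi⟩ := ih x hx1
    have hxU : φ.toFun^[n] x ∈ φ.dom := hx2 0 (by omega)
    obtain ⟨e, hes, he⟩ := φ.isLocalHomeomorphOn _ hxU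
    have hVo : IsOpen (e.source ∩ φ.dom) := e.open_source.inter φ.isOpen_dom
    have hiter : φ.toFun^[n + 1] = φ.toFun ∘ φ.toFun^[n] := Function.iterate_succ' _ _
    refine ⟨W ∩ φ.toFun^[n] ⁻¹' (e.source ∩ φ.dom), hWc.isOpen_inter_preimage hWo hVo,
      ⟨hxW, hes, hxU⟩, ?_, ?_, ?_⟩
    · rintro y ⟨hyW, -, hyU⟩
      refine mem_iterDom_add.2 ⟨hWD hyW, fun i hi => ?_⟩
      obtain rfl : i = 0 := by omega
      exact hyU
    · rw [hiter]
      refine ContinuousOn.comp (t := e.source) ?_ (hWc.mono inter_subset_left)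
        (fun y hy => hy.2.1)
      rw [he]
      exact e.continuousOn
    · rw [hiter]
      refine InjOn.comp (t := e.source) ?_ (hWi.mono inter_subset_left) (fun y hy => hy.2.1)
      rw [he]
      exact e.injOn

/-- Every point of the groupoid has an open neighbourhood on which the range and source maps are
injective. -/
theorem exists_bisection (g : φ.Gpd) : ∃ B : Set φ.Gpd, IsOpen B ∧ g ∈ B ∧
    InjOn Gpd.rng B ∧ InjOn Gpd.src B := by
  obtain ⟨n, m, hd, hr⟩ := g.exists_rel
  obtain ⟨W, hWo, hxW, hWD, -, hWi⟩ := exists_injOn_iterate n _ hr.1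
  obtain ⟨V, hVo, hyV, hVD, -, hVi⟩ := exists_injOn_iterate m _ hr.2.1
  refine ⟨basicSet φ n m W V,
    TopologicalSpace.isOpen_generateFrom_of_mem ⟨n, m, W, V, hWo, hWD, hVo, hVD, rfl⟩,
    ⟨hd, hr, hxW, hyV⟩, ?_, ?_⟩
  · rintro a ⟨had, har, -, haV⟩ b ⟨hbd, hbr, -, hbV⟩ hab
    refine Gpd.ext hab (had.trans hbd.symm) (hVi haV hbV ?_)
    rw [← har.2.2, ← hbr.2.2, hab]
  · rintro a ⟨had, har, haW, -⟩ b ⟨hbd, hbr, hbW, -⟩ hab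
    refine Gpd.ext (hWi haW hbW ?_) (had.trans hbd.symm) hab
    rw [har.2.2, hbr.2.2, hab]

theorem exists_card_bound {K : Set φ.Gpd} (hK : IsCompact K) : ∃ N : ℕ,
    (∀ x, ∀ s : Finset φ.Gpd, (∀ g ∈ s, g ∈ K ∧ g.rng = x) → s.card ≤ N) ∧
    (∀ x, ∀ s : Finset φ.Gpd, (∀ g ∈ s, g ∈ K ∧ g.src = x) → s.card ≤ N) := by
  classical
  choose B hBo hB hBr hBs using (exists_bisection : ∀ g : φ.Gpd, _)
  obtain ⟨t, ht⟩ := hK.elim_finite_subcover B hBo (fun g _ => mem_iUnion.2 ⟨g, hB g⟩)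
  have hch : ∀ g : φ.Gpd, ∃ i, g ∈ K → i ∈ t ∧ g ∈ B i := fun g => by
    by_cases hg : g ∈ K
    · obtain ⟨i, hi, hgi⟩ := mem_iUnion₂.1 (ht hg)
      exact ⟨i, fun _ => ⟨hi, hgi⟩⟩
    · exact ⟨g, fun h => (hg h).elim⟩
  choose c hc using hch
  refine ⟨t.card, fun x s hs => ?_, fun x s hs => ?_⟩
  · refine Finset.card_le_card_of_injOn c (fun g hg => (hc g (hs g hg).1).1) ?_
    intro a ha b hb hab
    refine hBr (c a) (hc a (hs a ha).1).2 (hab ▸ (hc b (hs b hb).1).2) ?_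
    rw [(hs a ha).2, (hs b hb).2]
  · refine Finset.card_le_card_of_injOn c (fun g hg => (hc g (hs g hg).1).1) ?_
    intro a ha b hb hab
    refine hBs (c a) (hc a (hs a ha).1).2 (hab ▸ (hc b (hs b hb).1).2) ?_
    rw [(hs a ha).2, (hs b hb).2]

end Gpd

end PartialLocalHomeo

/-! ## Operators on `ℓ²` given by band matrices -/

namespace BandMatrix

variable {ι : Type*}

/-- The entries of `k` are bounded by `C`, and each row and each column has at most `N` non-zero
entries. -/
structure IsBand (k : ι → ι → ℂ) (N : ℕ) (C : ℝ) : Prop where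
  norm_le : ∀ i j, ‖k i j‖ ≤ C
  row : ∀ i, ∀ s : Finset ι, (∀ j ∈ s, k i j ≠ 0) → s.card ≤ N
  col : ∀ j, ∀ s : Finset ι, (∀ i ∈ s, k i j ≠ 0) → s.card ≤ N

variable {k : ι → ι → ℂ} {N : ℕ} {C : ℝ}

theorem finite_of_card_le {S : Set ι} (h : ∀ s : Finset ι, (∀ j ∈ s, j ∈ S) → s.card ≤ N) :
    S.Finite := by
  by_contra hS
  obtain ⟨t, htS, htc⟩ := Set.Infinite.exists_subset_card_eq hS (N + 1)
  have := h t (fun j hj => htS hj)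
  omega

theorem IsBand.finite_row (hk : IsBand k N C) (i : ι) : {j | k i j ≠ 0}.Finite :=
  finite_of_card_le (hk.row i)

theorem IsBand.tsum_eq (hk : IsBand k N C) (i : ι) (ψ : ι → ℂ) :
    ∑' j, k i j * ψ j = ∑ j ∈ (hk.finite_row i).toFinset, k i j * ψ j := by
  refine tsum_eq_sum fun j hj => ?_
  have : k i j = 0 := by simpa using hj
  rw [this, zero_mul]

theorem IsBand.sum_sq_le (hk : IsBand k N C) (ψ : ℓ²(ι, ℂ)) (s : Finset ι) :
    ∑ i ∈ s, ‖∑' j, k i j * ψ j‖ ^ 2 ≤ (N * C * ‖ψ‖) ^ 2 := by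
  classical
  have hψ : ∀ T : Finset ι, ∑ j ∈ T, ‖ψ j‖ ^ 2 ≤ ‖ψ‖ ^ 2 := fun T => by
    have := lp.sum_rpow_le_norm_rpow (p := 2) (by norm_num) ψ T
    simpa using this
  set R : ι → Finset ι := fun i => (hk.finite_row i).toFinset with hR
  have hRm : ∀ i j, j ∈ R i ↔ k i j ≠ 0 := fun i j => by simp [hR]
  have h1 : ∀ i, ‖∑' j, k i j * ψ j‖ ^ 2 ≤ N * C ^ 2 * ∑ j ∈ R i, ‖ψ j‖ ^ 2 := fun i => by
    rw [hk.tsum_eq i]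
    have hcard : ((R i).card : ℝ) ≤ N := by
      exact_mod_cast hk.row i (R i) (fun j hj => (hRm i j).1 hj)
    calc ‖∑ j ∈ R i, k i j * ψ j‖ ^ 2 ≤ (∑ j ∈ R i, ‖k i j * ψ j‖) ^ 2 := by
          gcongr
          exact norm_sum_le _ _
      _ ≤ (R i).card * ∑ j ∈ R i, ‖k i j * ψ j‖ ^ 2 := sq_sum_le_card_mul_sum_sq
      _ ≤ N * ∑ j ∈ R i, C ^ 2 * ‖ψ j‖ ^ 2 := by
          gcongr with j hj
          rw [norm_mul, mul_pow]
          gcongr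
          exact hk.norm_le i j
      _ = N * C ^ 2 * ∑ j ∈ R i, ‖ψ j‖ ^ 2 := by rw [← Finset.mul_sum]; ring
  calc ∑ i ∈ s, ‖∑' j, k i j * ψ j‖ ^ 2
      ≤ ∑ i ∈ s, N * C ^ 2 * ∑ j ∈ R i, ‖ψ j‖ ^ 2 := Finset.sum_le_sum fun i _ => h1 i
    _ = N * C ^ 2 * ∑ i ∈ s, ∑ j ∈ R i, ‖ψ j‖ ^ 2 := by rw [← Finset.mul_sum]
    _ = N * C ^ 2 * ∑ j ∈ s.biUnion R, ∑ i ∈ s.filter (fun i => j ∈ R i), ‖ψ j‖ ^ 2 := by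
        congr 1
        refine Finset.sum_comm' fun i j => ?_
        simp only [Finset.mem_biUnion, Finset.mem_filter]
        tauto
    _ ≤ N * C ^ 2 * ∑ j ∈ s.biUnion R, N * ‖ψ j‖ ^ 2 := by
        gcongr with j hj
        rw [Finset.sum_const, nsmul_eq_mul]
        gcongr
        exact_mod_cast hk.col j _ (fun i hi => (hRm i j).1 (Finset.mem_filter.1 hi).2)
    _ = N * C ^ 2 * (N * ∑ j ∈ s.biUnion R, ‖ψ j‖ ^ 2) := by rw [← Finset.mul_sum]
    _ ≤ N * C ^ 2 * (N * ‖ψ‖ ^ 2) := by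
        gcongr
        exact hψ _
    _ = (N * C * ‖ψ‖) ^ 2 := by ring

/-- The bounded operator `(T ψ)(i) = ∑_j k(i, j) ψ(j)` on `ℓ²(ι)`. -/
def toCLM (k : ι → ι → ℂ) (N : ℕ) (C : ℝ) (hC : 0 ≤ C) (hk : IsBand k N C) :
    ℓ²(ι, ℂ) →L[ℂ] ℓ²(ι, ℂ) :=
  LinearMap.mkContinuous
    { toFun := fun ψ => ⟨fun i => ∑' j, k i j * ψ j,
        memℓp_gen' (C := (N * C * ‖ψ‖) ^ 2) fun s => by simpa using hk.sum_sq_le ψ s⟩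
      map_add' := fun ψ ψ' => by
        ext i
        change ∑' j, k i j * (ψ j + ψ' j) = (∑' j, k i j * ψ j) + ∑' j, k i j * ψ' j
        rw [hk.tsum_eq i (fun j => ψ j), hk.tsum_eq i (fun j => ψ' j),
          hk.tsum_eq i (fun j => ψ j + ψ' j), ← Finset.sum_add_distrib]
        exact Finset.sum_congr rfl fun j _ => mul_add _ _ _
      map_smul' := fun c ψ => by
        ext i
        change ∑' j, k i j * (c * ψ j) = c * ∑' j, k i j * ψ j
        rw [← tsum_mul_left]
        exact tsum_congr fun j => by ring }
    (N * C) fun ψ => by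
      refine lp.norm_le_of_forall_sum_le (by norm_num) (by positivity) fun s => ?_
      simpa using hk.sum_sq_le ψ s

theorem toCLM_apply (hC : 0 ≤ C) (hk : IsBand k N C) (ψ : ℓ²(ι, ℂ)) (i : ι) :
    toCLM k N C hC hk ψ i = ∑' j, k i j * ψ j := rfl

theorem norm_toCLM_le (hC : 0 ≤ C) (hk : IsBand k N C) : ‖toCLM k N C hC hk‖ ≤ N * C :=
  LinearMap.mkContinuous_norm_le _ (by positivity) _

end BandMatrix

/-! ## The reduced C*-algebra of the groupoid -/

namespace PartialLocalHomeo

variable {X : Type*} [TopologicalSpace X] {φ : PartialLocalHomeo X}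

open Gpd

theorem exists_isBand (f : C_c(φ.Gpd, ℂ)) : ∃ (N : ℕ) (C : ℝ), 0 ≤ C ∧
    ∀ x : X, BandMatrix.IsBand (fun g h : Fiber φ x => f (g.div h)) N C := by
  classical
  obtain ⟨C, hC⟩ := f.hasCompactSupport.exists_bound_of_continuous f.continuous
  obtain ⟨N, hNr, hNs⟩ := exists_card_bound f.hasCompactSupport.isCompact
  have hsupp : ∀ g, f g ≠ 0 → g ∈ tsupport f := fun g hg => subset_tsupport _ hg
  refine ⟨N, max C 0, le_max_right _ _, fun x =>
    ⟨fun g h => (hC _).trans (le_max_left _ _), fun g s hs => ?_, fun h s hs => ?_⟩⟩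
  · have hinj : Function.Injective (fun h : Fiber φ x => g.div h) := fun a b hab => by
      have h1 := congrArg Gpd.deg hab
      have h2 := congrArg Gpd.src hab
      simp only [Fiber.div, mul, inv] at h1 h2
      exact Subtype.ext (Gpd.ext h2 (by omega) (a.2.trans b.2.symm))
    rw [← Finset.card_image_of_injective s hinj]
    refine hNr g.1.rng _ fun a ha => ?_
    obtain ⟨h, hh, rfl⟩ := Finset.mem_image.1 ha
    exact ⟨hsupp _ (hs h hh), rfl⟩
  · have hinj : Function.Injective (fun g : Fiber φ x => g.div h) := fun a b hab => by
      have h1 := congrArg Gpd.deg hab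
      have h2 := congrArg Gpd.rng hab
      simp only [Fiber.div, mul, inv] at h1 h2
      exact Subtype.ext (Gpd.ext h2 (by omega) (a.2.trans b.2.symm))
    rw [← Finset.card_image_of_injective s hinj]
    refine hNs h.1.rng _ fun a ha => ?_
    obtain ⟨g, hg, rfl⟩ := Finset.mem_image.1 ha
    exact ⟨hsupp _ (hs g hg), rfl⟩

/-- The representation `π_x` of `C_c(G)` on `ℓ²(G_x)`, where `G_x = s⁻¹(x)`:
`(π_x(f) ψ)(g) = ∑_{h ∈ G_x} f(g h⁻¹) ψ(h)`, which is
`∑_{h ∈ r⁻¹(r(g))} f(h) ψ(h⁻¹ g)` after the substitution `h ↦ g h⁻¹`. -/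
def regRep (f : C_c(φ.Gpd, ℂ)) (x : X) : ℓ²(Fiber φ x, ℂ) →L[ℂ] ℓ²(Fiber φ x, ℂ) :=
  BandMatrix.toCLM (fun g h : Fiber φ x => f (g.div h)) (exists_isBand f).choose
    (exists_isBand f).choose_spec.choose (exists_isBand f).choose_spec.choose_spec.1
    ((exists_isBand f).choose_spec.choose_spec.2 x)

theorem regRep_apply (f : C_c(φ.Gpd, ℂ)) (x : X) (ψ : ℓ²(Fiber φ x, ℂ)) (g : Fiber φ x) :
    regRep f x ψ g = ∑' h : Fiber φ x, f (g.div h) * ψ h := rfl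

variable (φ) in
/-- The C*-algebra of all bounded families `(T_x)`, `x ∈ X`, of operators `T_x ∈ B(ℓ²(G_x))`, with
the norm `sup_x ‖T_x‖`. -/
def OperatorFamilies : Type _ :=
  lp (fun x : X => ℓ²(Fiber φ x, ℂ) →L[ℂ] ℓ²(Fiber φ x, ℂ)) ∞

instance : NonUnitalCStarAlgebra (OperatorFamilies φ) :=
  inferInstanceAs (NonUnitalCStarAlgebra
    (lp (fun x : X => ℓ²(Fiber φ x, ℂ) →L[ℂ] ℓ²(Fiber φ x, ℂ)) ∞))

theorem memlp_regRep (f : C_c(φ.Gpd, ℂ)) :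
    Memℓp (E := fun x : X => ℓ²(Fiber φ x, ℂ) →L[ℂ] ℓ²(Fiber φ x, ℂ)) (regRep f) ∞ := by
  refine memℓp_infty ⟨(exists_isBand f).choose * (exists_isBand f).choose_spec.choose, ?_⟩
  rintro _ ⟨x, rfl⟩
  exact BandMatrix.norm_toCLM_le _ _

/-- `f ↦ (π_x(f))_x`; the norm of the image is `sup_x ‖π_x(f)‖`. -/
def regRepFamily (f : C_c(φ.Gpd, ℂ)) : OperatorFamilies φ := ⟨regRep f, memlp_regRep f⟩

theorem norm_regRepFamily (f : C_c(φ.Gpd, ℂ)) : ‖regRepFamily f‖ = ⨆ x : X, ‖regRep f x‖ :=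
  lp.norm_eq_ciSup _

variable (φ) in
/-- The completion of `C_c(G)` in the norm `sup_x ‖π_x(f)‖`, realised as the closure of the image
of `C_c(G)` under the isometric embedding `f ↦ (π_x(f))_x`. (This image is a `*`-algebra, since the
`π_x` are representations of the convolution algebra; so it is the `*`-algebra it generates.) -/
def reducedSubalgebra : NonUnitalStarSubalgebra ℂ (OperatorFamilies φ) :=
  (NonUnitalStarAlgebra.adjoin ℂ (Set.range (regRepFamily (φ := φ)))).topologicalClosure

variable (φ) in
/-- The reduced groupoid C*-algebra of the groupoid of `φ`. -/
def ReducedCStar : Type _ := reducedSubalgebra φ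

instance : IsClosed (reducedSubalgebra φ : Set (OperatorFamilies φ)) :=
  NonUnitalStarSubalgebra.isClosed_topologicalClosure _

instance : NonUnitalCStarAlgebra (ReducedCStar φ) :=
  inferInstanceAs (NonUnitalCStarAlgebra (reducedSubalgebra φ))

instance : PartialOrder (ReducedCStar φ) := CStarAlgebra.spectralOrder _

instance : StarOrderedRing (ReducedCStar φ) := CStarAlgebra.spectralOrderedRing _

/-- The inclusion of `C_c(G)` in the reduced C*-algebra. -/
def ofCc (f : C_c(φ.Gpd, ℂ)) : ReducedCStar φ :=
  ⟨regRepFamily f, NonUnitalStarSubalgebra.le_topologicalClosure _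
    (NonUnitalStarAlgebra.subset_adjoin ℂ _ ⟨f, rfl⟩)⟩

theorem norm_ofCc (f : C_c(φ.Gpd, ℂ)) : ‖ofCc f‖ = ⨆ x : X, ‖regRep f x‖ :=
  norm_regRepFamily f

/-- The extension of `π_x` to the reduced C*-algebra. -/
def rep (a : ReducedCStar φ) (x : X) : ℓ²(Fiber φ x, ℂ) →L[ℂ] ℓ²(Fiber φ x, ℂ) :=
  (show lp (fun x : X => ℓ²(Fiber φ x, ℂ) →L[ℂ] ℓ²(Fiber φ x, ℂ)) ∞ from a.1) x

theorem rep_ofCc (f : C_c(φ.Gpd, ℂ)) (x : X) : rep (ofCc f) x = regRep f x := rfl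

theorem rep_sub (a b : ReducedCStar φ) (x : X) : rep (a - b) x = rep a x - rep b x := rfl

theorem norm_rep_le (a : ReducedCStar φ) (x : X) : ‖rep a x‖ ≤ ‖a‖ :=
  lp.norm_apply_le_norm (E := fun x : X => ℓ²(Fiber φ x, ℂ) →L[ℂ] ℓ²(Fiber φ x, ℂ))
    ENNReal.top_ne_zero a.1 x

open Classical in
/-- The canonical conditional expectation onto `C_0(X)`, `X` being identified with the unit space;
it takes an element `a` to the function `x ↦ ⟨π_x(a) δ_x, δ_x⟩`. By `condExp_ofCc` and
`norm_condExp_le` it is the continuous extension of the restriction map `C_c(G) → C_c(X)`. -/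
def condExp (a : ReducedCStar φ) (x : X) : ℂ :=
  rep a x (lp.single 2 (Fiber.unit φ x) 1) (Fiber.unit φ x)

theorem condExp_ofCc (f : C_c(φ.Gpd, ℂ)) (x : X) : condExp (ofCc f) x = f (Gpd.unit φ x) := by
  classical
  change regRep f x (lp.single 2 (Fiber.unit φ x) 1) (Fiber.unit φ x) = _
  rw [regRep_apply, tsum_eq_single (Fiber.unit φ x)]
  · simp only [lp.single_apply_self, mul_one]
    rfl
  · intro h hh
    rw [lp.single_apply_ne _ _ _ hh, mul_zero]

theorem condExp_sub (a b : ReducedCStar φ) (x : X) :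
    condExp (a - b) x = condExp a x - condExp b x := rfl

theorem norm_condExp_le (a : ReducedCStar φ) (x : X) : ‖condExp a x‖ ≤ ‖a‖ := by
  classical
  have h1 : ‖(lp.single 2 (Fiber.unit φ x) 1 : ℓ²(Fiber φ x, ℂ))‖ = 1 := by
    rw [lp.norm_single (by norm_num), norm_one]
  calc ‖condExp a x‖ ≤ ‖rep a x (lp.single 2 (Fiber.unit φ x) 1)‖ :=
        lp.norm_apply_le_norm (by norm_num) _ _
    _ ≤ ‖rep a x‖ * ‖(lp.single 2 (Fiber.unit φ x) 1 : ℓ²(Fiber φ x, ℂ))‖ :=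
        (rep a x).le_opNorm _
    _ = ‖rep a x‖ := by rw [h1, mul_one]
    _ ≤ ‖a‖ := norm_rep_le a x

/-- The weight `φ_m(a) = ∫ P(a) dm`, where `P = condExp` (`P(a) ≥ 0` when `a ≥ 0`). -/
def measureWeight [MeasurableSpace X] (m : Measure X) (a : ReducedCStar φ) : ℝ≥0∞ :=
  ∫⁻ x, ENNReal.ofReal (condExp a x).re ∂m

/-- A weight on the reduced C*-algebra is diagonal when it is of the form `φ_m` for a
regular Borel measure `m` on the unit space. -/
def IsDiagonal [MeasurableSpace X] (ψ : ReducedCStar φ → ℝ≥0∞) : Prop :=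
  ∃ m : Measure X, m.Regular ∧ ∀ a : ReducedCStar φ, 0 ≤ a → ψ a = measureWeight m a

end PartialLocalHomeo

end

/-! The proof shows that $\alpha$ fixes the diagonal $C_0(X)$ pointwise, and then that an action
fixing the diagonal is multiplication by a phase on the groupoid.

Let $m$ be the measure of the weight $\psi$. If $m$ vanishes on a neighbourhood of $s(g)$, choose
$f\in C_c(\mathcal G_\varphi)$ supported over it with $f(g)=1$. The KMS function
$\psi(f^*\alpha_t(f))$ is zero on $\mathbb R$, hence zero at $i\beta$, so $\psi(ff^*)=0$ and $m$
vanishes near $r(g)$ (`exists_null_nhds_rng`). By minimality, a non-empty null open set would make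
$m$ zero; thus $m$ has full support (`isOpenPosMeasure`).

Let $d\in C_c(X)$ be real. Since $P(db)=P(bd)$ for all $b$, the KMS function of the pair $(d,d)$ is
$i\beta$-periodic, extends to a bounded entire function and is constant by Liouville. With the
invariance of $\psi$ this gives $\psi((\alpha_t(d)-d)^2)=0$, and full support gives $\alpha_t(d)=d$
(`apply_diag_eq`).

Elements of $A$ are functions on the groupoid (`coeff`). If $s(g)$ has trivial isotropy, cutting
$a\in C_c(\mathcal G_\varphi)$ by diagonal functions near $r(g)$ and $s(g)$ leaves a function
supported in a small bisection around $g$, of norm at most $|a(g)|+\varepsilon$. An automorphism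
$\theta$ fixing the diagonal therefore satisfies $|\theta(a)(g)|\le|a(g)|$. The orbit of the
aperiodic point is dense and has trivial isotropy, so the inequality holds for all $g$
(`norm_coeff_apply_le`), and $\theta$ is multiplication by a function (`exists_multiplier`).

For $\theta=\alpha_t$ these multipliers form a bounded one-parameter group in $t$, so they equal
$e^{itc}$ with $c$ a continuous real homomorphism (`exists_continuous_homomorphism`). Finally
$c=c_F$ with $F(x)=c(x,1,\varphi(x))$ (`exists_eq_cocycle`). -/

/-! ## Complex analysis on strips and one-parameter groups of phases -/

namespace StripAnalysis

open Complex
open scoped Interval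

/-- A continuous function on an open set that is holomorphic off the real line is holomorphic. -/
theorem differentiableOn_of_continuousOn_off_real {f : ℂ → ℂ} {U : Set ℂ} (hU : IsOpen U)
    (hc : ContinuousOn f U) (hd : ∀ z ∈ U, z.im ≠ 0 → DifferentiableAt ℂ f z) :
    DifferentiableOn ℂ f U := by
  refine (isConservativeOn_and_continuousOn_iff_isDifferentiableOn hU).1 ⟨?_, hc⟩
  -- Morera: Cauchy's theorem on a rectangle needs holomorphy only in the open interior, so it
  -- covers rectangles not crossing the real line. The others are cut in two along it.
  have key : ∀ z w : ℂ, [[z.re, w.re]] ×ℂ [[z.im, w.im]] ⊆ U →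
      (0 : ℝ) ∉ Ioo (min z.im w.im) (max z.im w.im) →
      wedgeIntegral z w f + wedgeIntegral w z f = 0 := by
    intro z w hR h0
    rw [wedgeIntegral_add_wedgeIntegral_eq]
    refine integral_boundary_rect_eq_zero_of_continuousOn_of_differentiableOn f z w
      (hc.mono hR) fun x hx => (hd x (hR ?_) ?_).differentiableWithinAt
    · exact ⟨Ioo_subset_Icc_self hx.1, Ioo_subset_Icc_self hx.2⟩
    · intro h
      exact h0 (h ▸ hx.2)
  intro z w hR
  rw [eq_neg_iff_add_eq_zero]
  change [[z.re, w.re]] ×ℂ [[z.im, w.im]] ⊆ U at hR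
  by_cases h0 : (0 : ℝ) ∈ Ioo (min z.im w.im) (max z.im w.im)
  swap
  · exact key z w hR h0
  have h0' : (0 : ℝ) ∈ [[z.im, w.im]] := Ioo_subset_Icc_self h0
  have h1 := key z (w.re : ℂ) (fun x hx => hR ⟨by simpa using hx.1,
      uIcc_subset_uIcc_left h0' (by simpa using hx.2)⟩) (by
    simp only [ofReal_im]; rintro ⟨h, h'⟩
    rcases le_total z.im 0 with hz | hz <;> simp [hz] at h h')
  have h2 := key (z.re : ℂ) w (fun x hx => hR ⟨by simpa using hx.1,
      uIcc_subset_uIcc_right h0' (by simpa using hx.2)⟩) (by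
    simp only [ofReal_im]; rintro ⟨h, h'⟩
    rcases le_total w.im 0 with hz | hz <;> simp [hz] at h h')
  rw [wedgeIntegral_add_wedgeIntegral_eq] at h1 h2 ⊢
  simp only [ofReal_re, ofReal_im] at h1 h2
  have hI : ∀ a ∈ [[z.re, w.re]], ∀ b₁ ∈ [[z.im, w.im]], ∀ b₂ ∈ [[z.im, w.im]],
      IntervalIntegrable (fun y : ℝ => f (a + y * I)) volume b₁ b₂ := by
    intro a ha b₁ hb₁ b₂ hb₂
    refine ContinuousOn.intervalIntegrable (hc.comp (by fun_prop) fun y hy => hR ?_)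
    exact ⟨by simpa using ha, by simpa using uIcc_subset_uIcc hb₁ hb₂ hy⟩
  have e1 := intervalIntegral.integral_add_adjacent_intervals
    (hI w.re right_mem_uIcc _ left_mem_uIcc _ h0') (hI w.re right_mem_uIcc _ h0' _ right_mem_uIcc)
  have e2 := intervalIntegral.integral_add_adjacent_intervals
    (hI z.re left_mem_uIcc _ left_mem_uIcc _ h0') (hI z.re left_mem_uIcc _ h0' _ right_mem_uIcc)
  rw [← e1, ← e2]
  simp only [smul_add]
  linear_combination h1 + h2

/-- Liouville's theorem: the translates of `F` by multiples of `β * I` fit together into a bounded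
entire function, holomorphy across the seams coming from the Morera argument. -/
theorem eq_of_periodic_of_pos {F : ℂ → ℂ} {β : ℝ} (hβ : 0 < β)
    (hc : ContinuousOn F (im ⁻¹' Icc 0 β)) {C : ℝ} (hC : ∀ z, z.im ∈ Icc 0 β → ‖F z‖ ≤ C)
    (hd : ∀ z, z.im ∈ Ioo 0 β → DifferentiableAt ℂ F z)
    (hp : ∀ t : ℝ, F (t + β * I) = F t) (t : ℝ) : F t = F 0 := by
  -- extension to a neighbourhood of the real line
  let E : ℂ → ℂ := fun z => if 0 ≤ z.im then F z else F (z + β * I)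
  have hUo : IsOpen (im ⁻¹' Ioo (-β) β) := isOpen_Ioo.preimage continuous_im
  have hEc : ContinuousOn E (im ⁻¹' Ioo (-β) β) := by
    refine ContinuousOn.if ?_ ?_ ?_
    · rintro z ⟨hz, hz0⟩
      rw [frontier_setOfPred_le_im] at hz0
      have : z.im = 0 := hz0
      rw [show z = (z.re : ℂ) from by apply Complex.ext <;> simp [this], hp]
    · refine hc.mono ?_
      rintro z ⟨hz, hz0⟩
      rw [(isClosed_le continuous_const continuous_im).closure_eq] at hz0
      exact ⟨hz0, hz.2.le⟩
    · refine hc.comp (by fun_prop) ?_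
      rintro z ⟨hz, hz0⟩
      simp only [not_le] at hz0
      rw [closure_setOfPred_im_lt] at hz0
      have h1 : z.im ≤ 0 := hz0
      have h2 := hz.1
      constructor <;> simp <;> linarith
  have hEd : DifferentiableOn ℂ E (im ⁻¹' Ioo (-β) β) := by
    refine differentiableOn_of_continuousOn_off_real hUo hEc fun z hz hz0 => ?_
    rcases lt_or_gt_of_ne hz0 with h | h
    · have h1 : DifferentiableAt ℂ (fun z => F (z + β * I)) z := by
        refine DifferentiableAt.comp (f := fun z : ℂ => z + β * I) z (hd _ ?_) (by fun_prop)
        have := hz.1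
        constructor <;> simp <;> linarith
      refine h1.congr_of_eventuallyEq ?_
      filter_upwards [(isOpen_Iio.preimage continuous_im).mem_nhds (show z ∈ im ⁻¹' Iio 0 from h)]
        with y hy
      exact if_neg (not_le.2 hy)
    · refine (hd z ⟨h, hz.2⟩).congr_of_eventuallyEq ?_
      filter_upwards [(isOpen_Ioi.preimage continuous_im).mem_nhds (show z ∈ im ⁻¹' Ioi 0 from h)]
        with y hy
      exact if_pos (le_of_lt hy)
  -- the periodic extension
  let N : ℂ → ℤ := fun z => ⌊z.im / β⌋
  let G : ℂ → ℂ := fun z => F (z - N z * β * I)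
  have hN : ∀ (z : ℂ) (n : ℤ), N z = n ↔ n * β ≤ z.im ∧ z.im < (n + 1) * β := fun z n => by
    simp only [N, Int.floor_eq_iff, le_div_iff₀ hβ, div_lt_iff₀ hβ]
  have hNI : ∀ z, (z - N z * β * I).im ∈ Ico 0 β := fun z => by
    have := (hN z _).1 rfl
    simp
    constructor <;> linarith
  -- Around the `n`-th seam `G` is a translate of `E`. The open strips of height `2 * β` about the
  -- seams cover the plane, so `G` is entire.
  have hGE : ∀ (n : ℤ) (z : ℂ), (z - n * β * I).im ∈ Ioo (-β) β → G z = E (z - n * β * I) := by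
    intro n z hz
    simp only [sub_im, mul_im, mul_re, intCast_re, intCast_im, ofReal_re, ofReal_im, I_re, I_im,
      mem_Ioo] at hz
    by_cases h : 0 ≤ (z - n * β * I).im
    · have : N z = n := by
        rw [hN]
        simp at h hz
        constructor <;> linarith
      simp only [E, if_pos h, G, this]
    · have : N z = n - 1 := by
        rw [hN]
        simp at h hz ⊢
        constructor <;> linarith
      simp only [E, if_neg h, G, this]
      congr 1
      push_cast
      ring
  have hGd : Differentiable ℂ G := by
    intro z
    have hz := hNI z
    have hz' : (z - N z * β * I) ∈ im ⁻¹' Ioo (-β) β := ⟨by linarith [hz.1], hz.2⟩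
    have h1 : DifferentiableAt ℂ (fun w => E (w - N z * β * I)) z :=
      DifferentiableAt.comp (f := fun w : ℂ => w - N z * β * I) z
        (hEd.differentiableAt (hUo.mem_nhds hz')) (by fun_prop)
    refine h1.congr_of_eventuallyEq ?_
    have ho : IsOpen ((fun w : ℂ => w - N z * β * I) ⁻¹' (im ⁻¹' Ioo (-β) β)) :=
      hUo.preimage (by fun_prop)
    filter_upwards [ho.mem_nhds hz'] with w hw
    exact hGE _ w hw
  have hGb : Bornology.IsBounded (range G) := by
    refine isBounded_iff_forall_norm_le.2 ⟨C, ?_⟩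
    rintro _ ⟨z, rfl⟩
    exact hC _ (Ico_subset_Icc_self (hNI z))
  have hGt : ∀ s : ℝ, G s = F s := fun s => by
    have : N s = 0 := by simp [N]
    simp [G, this]
  have := hGd.apply_eq_apply_of_bounded hGb t 0
  rw [hGt] at this
  simpa [this] using hGt 0

/-- The three lines theorem with bound `0` on one edge forces `F` to vanish at interior points of
the imaginary axis; continuity then reaches the other edge. -/
theorem eq_zero_of_eq_zero_of_pos {F : ℂ → ℂ} {β : ℝ} (hβ : 0 < β)
    (hc : ContinuousOn F (im ⁻¹' Icc 0 β)) {C : ℝ} (hC : ∀ z, z.im ∈ Icc 0 β → ‖F z‖ ≤ C)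
    (hd : ∀ z, z.im ∈ Ioo 0 β → DifferentiableAt ℂ F z)
    (h0 : ∀ t : ℝ, F t = 0) : F (β * I) = 0 := by
  have hin : ∀ s ∈ Ioo 0 β, F (s * I) = 0 := by
    intro s hs
    have hmaps : ∀ z : ℂ, (-I * -z).im = z.re := fun z => by simp
    have hcl : closure (HadamardThreeLines.verticalStrip 0 β) ⊆
        HadamardThreeLines.verticalClosedStrip 0 β :=
      closure_minimal (preimage_mono Ioo_subset_Icc_self) (isClosed_Icc.preimage continuous_re)
    -- Multiplication by `I` carries the vertical strip of the three lines theorem to the horizontal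
    -- one.
    have := HadamardThreeLines.norm_le_interp_of_mem_verticalClosedStrip' (f := fun z => F (-I * -z))
      (z := (s : ℂ)) (a := 0) (b := C) hβ
      (by simpa [HadamardThreeLines.verticalClosedStrip] using ⟨hs.1.le, hs.2.le⟩)
      ⟨fun z hz => DifferentiableAt.differentiableWithinAt
          (DifferentiableAt.comp (f := fun z : ℂ => -I * -z) z
            (hd _ (by rw [hmaps]; exact hz)) (by fun_prop)),
        hc.comp (by fun_prop) fun z hz => by
          rw [mem_preimage, hmaps]
          exact hcl hz⟩
      (by
        refine ⟨C, ?_⟩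
        rintro _ ⟨z, hz, rfl⟩
        exact hC _ (by rw [hmaps]; exact hz))
      (fun z hz => by
        have hz0 : z.re = 0 := hz
        have : -I * -z = ((-z.im : ℝ) : ℂ) := by
          apply Complex.ext <;> simp [hz0]
        simp only [this, h0, norm_zero, le_refl])
      (fun z hz => hC _ (by rw [hmaps, show z.re = β from hz]; exact ⟨hβ.le, le_rfl⟩))
    -- The exponent of the zero bound must be non-zero, as `0 ^ 0 = 1`; this excludes `s = β`.
    have h1 : (1 : ℝ) - ((s : ℂ).re - 0) / (β - 0) ≠ 0 := by
      have : s / β < 1 := (div_lt_one hβ).2 hs.2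
      simp
      linarith
    rw [Real.zero_rpow h1, zero_mul] at this
    have h2 := norm_le_zero_iff.1 this
    rwa [show -I * -(s : ℂ) = s * I by ring] at h2
  have hcont : ContinuousOn (fun s : ℝ => F (s * I)) (Icc 0 β) :=
    hc.comp (by fun_prop) fun s hs => by simpa using hs
  have hcl : β ∈ closure (Ioo 0 β) := by
    rw [closure_Ioo hβ.ne]
    exact ⟨hβ.le, le_rfl⟩
  have hmem : (fun s : ℝ => F (s * I)) β ∈ closure {0} :=
    ((hcont β ⟨hβ.le, le_rfl⟩).mono Ioo_subset_Icc_self).mem_closure hcl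
      (fun s hs => hin s hs)
  simpa using hmem

/-! ### Strips for `β` of either sign -/

theorem interior_strip (β : ℝ) :
    interior (KMS.strip β) = im ⁻¹' Ioo (min 0 β) (max 0 β) := by
  change interior (im ⁻¹' Icc (min 0 β) (max 0 β)) = _
  rw [interior_preimage_im, interior_Icc]

/-- Reflection in the origin turns a function on the strip of `β` into one on that of `-β`. -/
theorem exists_strip_pos {F : ℂ → ℂ} {β : ℝ} (hβ : β ≠ 0) (hc : ContinuousOn F (KMS.strip β))
    (hC : ∃ C : ℝ, ∀ z ∈ KMS.strip β, ‖F z‖ ≤ C)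
    (hd : DifferentiableOn ℂ F (interior (KMS.strip β))) :
    ∃ σ : ℝ, (σ = 1 ∨ σ = -1) ∧ 0 < σ * β ∧
      ContinuousOn (fun z => F (σ * z)) (im ⁻¹' Icc 0 (σ * β)) ∧
      (∃ C : ℝ, ∀ z, z.im ∈ Icc 0 (σ * β) → ‖F (σ * z)‖ ≤ C) ∧
      ∀ z, z.im ∈ Ioo 0 (σ * β) → DifferentiableAt ℂ (fun z => F (σ * z)) z := by
  have hd' : ∀ z, z.im ∈ Ioo (min 0 β) (max 0 β) → DifferentiableAt ℂ F z := fun z hz =>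
    hd.differentiableAt (isOpen_interior.mem_nhds (by rw [interior_strip]; exact hz))
  obtain ⟨C, hC⟩ := hC
  have main : ∀ σ : ℝ, 0 < σ * β →
      (∀ z : ℂ, z.im ∈ Icc 0 (σ * β) → (σ * z).im ∈ [[0, β]]) →
      (∀ z : ℂ, z.im ∈ Ioo 0 (σ * β) → (σ * z).im ∈ Ioo (min 0 β) (max 0 β)) →
      0 < σ * β ∧ ContinuousOn (fun z => F (σ * z)) (im ⁻¹' Icc 0 (σ * β)) ∧
      (∃ C : ℝ, ∀ z, z.im ∈ Icc 0 (σ * β) → ‖F (σ * z)‖ ≤ C) ∧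
      ∀ z, z.im ∈ Ioo 0 (σ * β) → DifferentiableAt ℂ (fun z => F (σ * z)) z :=
    fun σ hσ h1 h2 => ⟨hσ, hc.comp (by fun_prop) fun z hz => h1 z hz,
      ⟨C, fun z hz => hC _ (h1 z hz)⟩, fun z hz =>
        DifferentiableAt.comp (f := fun z : ℂ => (σ : ℂ) * z) z (hd' _ (h2 z hz)) (by fun_prop)⟩
  rcases lt_or_gt_of_ne hβ with h | h
  · refine ⟨-1, Or.inr rfl, main (-1) (by linarith) (fun z hz => ?_) fun z hz => ?_⟩
    · rw [uIcc_of_ge h.le]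
      simp at hz ⊢
      constructor <;> linarith
    · rw [min_eq_right h.le, max_eq_left h.le]
      simp at hz ⊢
      constructor <;> linarith
  · refine ⟨1, Or.inl rfl, main 1 (by linarith) (fun z hz => ?_) fun z hz => ?_⟩
    · rw [uIcc_of_le h.le]
      simpa using hz
    · rw [min_eq_left h.le, max_eq_right h.le]
      simpa using hz

theorem eq_of_periodic {F : ℂ → ℂ} {β : ℝ} (hβ : β ≠ 0) (hc : ContinuousOn F (KMS.strip β))
    (hC : ∃ C : ℝ, ∀ z ∈ KMS.strip β, ‖F z‖ ≤ C)
    (hd : DifferentiableOn ℂ F (interior (KMS.strip β)))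
    (hp : ∀ t : ℝ, F (t + β * I) = F t) (t : ℝ) : F t = F 0 := by
  obtain ⟨σ, hσ, hpos, h1, ⟨C', h2⟩, h3⟩ := exists_strip_pos hβ hc hC hd
  have hσ2 : (σ : ℂ) * σ = 1 := by
    rcases hσ with rfl | rfl <;> simp
  have := eq_of_periodic_of_pos hpos h1 h2 h3 (fun s => by
    have := hp (σ * s)
    push_cast at this ⊢
    rw [← this]
    congr 1
    linear_combination (β : ℂ) * I * hσ2) (σ * t)
  simp only [mul_zero] at this
  rw [← this]
  congr 1
  push_cast
  linear_combination -(t : ℂ) * hσ2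

theorem eq_zero_of_eq_zero {F : ℂ → ℂ} {β : ℝ} (hβ : β ≠ 0) (hc : ContinuousOn F (KMS.strip β))
    (hC : ∃ C : ℝ, ∀ z ∈ KMS.strip β, ‖F z‖ ≤ C)
    (hd : DifferentiableOn ℂ F (interior (KMS.strip β)))
    (h0 : ∀ t : ℝ, F t = 0) : F (β * I) = 0 := by
  obtain ⟨σ, hσ, hpos, h1, ⟨C', h2⟩, h3⟩ := exists_strip_pos hβ hc hC hd
  have hσ2 : (σ : ℂ) * σ = 1 := by
    rcases hσ with rfl | rfl <;> simp
  have := eq_zero_of_eq_zero_of_pos hpos h1 h2 h3 (fun s => by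
    have := h0 (σ * s)
    push_cast at this
    exact this)
  rw [← this]
  congr 1
  push_cast
  linear_combination -(β : ℂ) * I * hσ2

/-- A jointly continuous family of bounded one-parameter groups in `ℂ` is given by a continuous
family of real exponents. -/
theorem exists_exponent {Y : Type*} [TopologicalSpace Y] {u : ℝ → Y → ℂ}
    (hu : Continuous fun p : ℝ × Y => u p.1 p.2) (h0 : ∀ y, u 0 y = 1)
    (hadd : ∀ s t y, u (s + t) y = u s y * u t y) (hb : ∀ t y, ‖u t y‖ ≤ 1) :
    ∃ c : Y → ℝ, Continuous c ∧ ∀ t y, u t y = exp (I * t * c y) := by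
  have huy : ∀ y, Continuous fun t => u t y := fun y =>
    hu.comp (continuous_id.prodMk continuous_const)
  -- Integration smooths: `u s * J T = J (s + T) - J s` makes `u` differentiable in `s` wherever `J
  -- T ≠ 0`, with generator `(u T - 1) / J T`. This quotient is continuous in `y`, which gives the
  -- continuity of the exponent.
  let J : ℝ → Y → ℂ := fun T y => ∫ t in (0 : ℝ)..T, u t y
  have hJd : ∀ T y, HasDerivAt (fun T => J T y) (u T y) T := fun T y =>
    intervalIntegral.integral_hasDerivAt_right ((huy y).intervalIntegrable _ _)
      ((huy y).stronglyMeasurableAtFilter _ _) (huy y).continuousAt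
  have hJc : ∀ T, Continuous (J T) := fun T => by
    refine intervalIntegral.continuous_parametric_intervalIntegral_of_continuous'
      (f := fun y t => u t y) ?_ 0 T
    exact hu.comp continuous_swap
  have hmul : ∀ s T y, u s y * J T y = J (s + T) y - J s y := fun s T y => by
    simp only [J]
    rw [← intervalIntegral.integral_const_mul,
      intervalIntegral.integral_interval_sub_left ((huy y).intervalIntegrable _ _)
        ((huy y).intervalIntegrable _ _)]
    have := intervalIntegral.integral_comp_add_left (fun t => u t y) s (a := 0) (b := T)
    rw [add_zero] at this
    rw [← this]
    exact intervalIntegral.integral_congr fun t _ => (hadd s t y).symm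
  have hderiv : ∀ T y, J T y ≠ 0 → ∀ s,
      HasDerivAt (fun s => u s y) (u s y * ((u T y - 1) / J T y)) s := fun T y hT s => by
    have h1 : (fun s => u s y) = fun s => (J (s + T) y - J s y) / J T y := by
      funext s
      rw [← hmul, mul_div_cancel_right₀ _ hT]
    have h2 := (((hJd (s + T) y).comp_add_const s T).sub (hJd s y)).div_const (J T y)
    rw [h1]
    exact h2.congr_deriv (by rw [hadd]; ring)
  -- If `J` vanished identically, its derivative at `0`, which is `u 0 y = 1`, would vanish too.
  have hex : ∀ y, ∃ T, J T y ≠ 0 := fun y => by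
    by_contra! h
    have h1 := hJd 0 y
    simp only [h] at h1
    have h2 := h1.unique (hasDerivAt_const (0 : ℝ) (0 : ℂ))
    rw [h0] at h2
    exact one_ne_zero h2
  let k : Y → ℂ := fun y => deriv (fun s => u s y) 0
  have hk : ∀ T y, J T y ≠ 0 → k y = (u T y - 1) / J T y := fun T y hT => by
    simp only [k]
    rw [(hderiv T y hT 0).deriv, h0, one_mul]
  have hkc : Continuous k := by
    refine continuous_iff_continuousAt.2 fun y => ?_
    obtain ⟨T, hT⟩ := hex y
    have h1 : ContinuousAt (fun y => (u T y - 1) / J T y) y :=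
      ((hu.comp (continuous_const.prodMk continuous_id)).sub continuous_const).continuousAt.div
        (hJc T).continuousAt hT
    refine h1.congr ?_
    filter_upwards [(hJc T).continuousAt.eventually_ne hT] with z hz
    exact (hk T z hz).symm
  have hexp : ∀ y (t : ℝ), u t y = exp (t * k y) := fun y t => by
    obtain ⟨T, hT⟩ := hex y
    have hd : ∀ s : ℝ, HasDerivAt (fun s : ℝ => u s y * exp (-(s * k y))) 0 s := fun s => by
      have h1 := hderiv T y hT s
      rw [← hk T y hT] at h1
      have h2 : HasDerivAt (fun s : ℝ => exp (-((s : ℂ) * k y)))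
          (exp (-(s * k y)) * -(1 * k y)) s :=
        (((hasDerivAt_id (s : ℂ)).comp_ofReal.mul_const (k y)).neg).cexp
      exact (h1.mul h2).congr_deriv (by ring)
    have h3 := is_const_of_deriv_eq_zero (fun s => (hd s).differentiableAt)
      (fun s => (hd s).deriv) t 0
    simp only [h0, ofReal_zero, zero_mul, neg_zero, exp_zero, mul_one] at h3
    rw [exp_neg, mul_inv_eq_one₀ (exp_ne_zero _)] at h3
    exact h3
  -- The bound by `1` at both `t = 1` and `t = -1` leaves only a purely imaginary generator.
  have hre : ∀ y, (k y).re = 0 := fun y => by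
    have h1 : ∀ t : ℝ, t * (k y).re ≤ 0 := fun t => by
      have := hb t y
      rw [hexp, norm_exp, Real.exp_le_one_iff] at this
      simpa using this
    have := h1 1
    have := h1 (-1)
    linarith
  refine ⟨fun y => (k y).im, continuous_im.comp hkc, fun t y => ?_⟩
  rw [hexp]
  congr 1
  apply Complex.ext <;> simp [hre]

end StripAnalysis

/-! ## The topology of the groupoid -/

namespace PartialLocalHomeo

variable {X : Type*} [TopologicalSpace X] {φ : PartialLocalHomeo X}

theorem isOpen_iterDom (n : ℕ) : IsOpen (φ.iterDom n) :=
  isOpen_iff_forall_mem_open.2 fun x hx =>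
    let ⟨W, hW, hxW, hWD, _⟩ := Gpd.exists_injOn_iterate n x hx
    ⟨W, hWD, hW, hxW⟩

theorem isLocalHomeomorphOn_iterate (n : ℕ) :
    IsLocalHomeomorphOn φ.toFun^[n] (φ.iterDom n) := by
  induction n with
  | zero => exact (Homeomorph.refl X).isLocalHomeomorph.isLocalHomeomorphOn.mono (subset_univ _)
  | succ n ih =>
    rw [Function.iterate_succ']
    refine φ.isLocalHomeomorphOn.comp (ih.mono fun x hx i hi => hx i (by omega))
      fun x hx => hx n (by omega)

theorem continuousAt_iterate {n : ℕ} {x : X} (hx : x ∈ φ.iterDom n) :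
    ContinuousAt φ.toFun^[n] x :=
  (isLocalHomeomorphOn_iterate n).continuousAt hx

namespace Gpd

/-- The open set of all `(x, n - m, y)` with `φⁿ(x) = φᵐ(y)`. -/
def relSet (φ : PartialLocalHomeo X) (n m : ℕ) : Set φ.Gpd :=
  {g | g.deg = (n : ℤ) - m ∧ φ.Rel n m g.rng g.src}

theorem exists_mem_relSet (g : φ.Gpd) : ∃ n m, g ∈ relSet φ n m := g.exists_rel

theorem isOpen_basicSet {n m : ℕ} {W V : Set X} (hW : IsOpen W) (hV : IsOpen V) :
    IsOpen (basicSet φ n m W V) := by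
  refine TopologicalSpace.isOpen_generateFrom_of_mem ⟨n, m, W ∩ φ.iterDom n, V ∩ φ.iterDom m,
    hW.inter (isOpen_iterDom n), inter_subset_right, hV.inter (isOpen_iterDom m),
    inter_subset_right, ?_⟩
  ext g
  exact ⟨fun h => ⟨h.1, h.2.1, ⟨h.2.2.1, h.2.1.1⟩, h.2.2.2, h.2.1.2.1⟩,
    fun h => ⟨h.1, h.2.1, h.2.2.1.1, h.2.2.2.1⟩⟩

theorem isOpen_relSet (n m : ℕ) : IsOpen (relSet φ n m) := by
  have : relSet φ n m = basicSet φ n m univ univ := by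
    ext g
    simp [relSet, basicSet]
  rw [this]
  exact isOpen_basicSet isOpen_univ isOpen_univ

theorem continuous_rng : Continuous (Gpd.rng : φ.Gpd → X) := by
  refine continuous_def.2 fun O hO => isOpen_iff_forall_mem_open.2 fun g hg => ?_
  obtain ⟨n, m, hd, hr⟩ := g.exists_rel
  exact ⟨basicSet φ n m O univ, fun h hh => hh.2.2.1, isOpen_basicSet hO isOpen_univ,
    hd, hr, hg, trivial⟩

theorem continuous_src : Continuous (Gpd.src : φ.Gpd → X) := by
  refine continuous_def.2 fun O hO => isOpen_iff_forall_mem_open.2 fun g hg => ?_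
  obtain ⟨n, m, hd, hr⟩ := g.exists_rel
  exact ⟨basicSet φ n m univ O, fun h hh => hh.2.2.2, isOpen_basicSet isOpen_univ hO,
    hd, hr, trivial, hg⟩

theorem continuous_deg : Continuous (Gpd.deg : φ.Gpd → ℤ) := by
  refine continuous_def.2 fun O hO => isOpen_iff_forall_mem_open.2 fun g hg => ?_
  obtain ⟨n, m, hd, hr⟩ := g.exists_rel
  refine ⟨relSet φ n m, fun h hh => ?_, isOpen_relSet n m, hd, hr⟩
  rw [mem_preimage, hh.1, ← hd]
  exact hg

/-- Convergence is convergence of range and source once the elements stay in one `relSet`. A basic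
set around the limit has indices differing from `n, m` by a common shift `j`. Raising the indices
means applying the `j`-th iterate; lowering them uses its local injectivity. -/
theorem tendsto_nhds {ι : Type*} {l : Filter ι} {f : ι → φ.Gpd} {g : φ.Gpd} {n m : ℕ}
    (hg : g ∈ relSet φ n m) (hr : Tendsto (fun i => (f i).rng) l (𝓝 g.rng))
    (hs : Tendsto (fun i => (f i).src) l (𝓝 g.src)) (hf : ∀ᶠ i in l, f i ∈ relSet φ n m) :
    Tendsto f l (𝓝 g) := by
  refine TopologicalSpace.tendsto_nhds_generateFrom_iff.2 ?_
  rintro _ ⟨p, q, W, V, hWo, hWD, hVo, hVD, rfl⟩ hgB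
  have hdeg : (n : ℤ) - m = p - q := hg.1.symm.trans hgB.1
  have hW := hr (hWo.mem_nhds hgB.2.2.1)
  have hV := hs (hVo.mem_nhds hgB.2.2.2)
  rcases le_total n p with hnp | hnp
  · obtain ⟨j, rfl⟩ := Nat.exists_eq_add_of_le hnp
    obtain rfl : q = m + j := by omega
    filter_upwards [hW, hV, hf] with i hiW hiV hif
    exact ⟨hif.1.trans hdeg, hif.2.add (hVD hiV), hiW, hiV⟩
  · obtain ⟨j, rfl⟩ := Nat.exists_eq_add_of_le hnp
    obtain rfl : m = q + j := by omega
    have hx := mem_iterDom_add.1 hg.2.1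
    have hy := mem_iterDom_add.1 hg.2.2.1
    obtain ⟨O, hO, hxO, -, -, hOi⟩ := exists_injOn_iterate j _ hx.2
    have h1 := ((continuousAt_iterate hx.1).tendsto.comp hr) (hO.mem_nhds hxO)
    have h2 := ((continuousAt_iterate hy.1).tendsto.comp hs)
      (hO.mem_nhds (hgB.2.1.2.2 ▸ hxO))
    filter_upwards [hW, hV, hf, h1, h2] with i hiW hiV hif hi1 hi2
    refine ⟨hif.1.trans hdeg, ⟨hWD hiW, hVD hiV, hOi hi1 hi2 ?_⟩, hiW, hiV⟩
    have := hif.2.2.2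
    rw [Nat.add_comm p j, Nat.add_comm q j, Function.iterate_add_apply,
      Function.iterate_add_apply] at this
    exact this

instance [T2Space X] : T2Space φ.Gpd := by
  refine T2Space.of_injective_continuous (f := fun g : φ.Gpd => (g.rng, g.deg, g.src)) ?_
    (continuous_rng.prodMk (continuous_deg.prodMk continuous_src))
  intro a b hab
  simp only [Prod.mk.injEq] at hab
  exact Gpd.ext hab.1 hab.2.1 hab.2.2

/-! ### Continuity of the groupoid operations and of the unit map -/

theorem inv_inv (g : φ.Gpd) : inv (inv g) = g := Gpd.ext rfl (neg_neg _) rfl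

theorem continuous_inv : Continuous (inv : φ.Gpd → φ.Gpd) := by
  refine continuous_iff_continuousAt.2 fun g => ?_
  obtain ⟨n, m, hg⟩ := g.exists_mem_relSet
  have h : ∀ g ∈ relSet φ n m, inv g ∈ relSet φ m n := fun g hg =>
    ⟨by simp [inv, hg.1], hg.2.symm⟩
  refine tendsto_nhds (h g hg) (continuous_src.tendsto g) (continuous_rng.tendsto g) ?_
  filter_upwards [(isOpen_relSet n m).mem_nhds hg] with i hi using h i hi

/-- The truncated differences raise the smaller of `m` and `p` to the larger. The resulting indices
do not depend on the elements, so products of nearby pairs stay in one `relSet`. -/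
theorem mul_mem_relSet {g h : φ.Gpd} (hgh : g.src = h.rng) {n m p q : ℕ}
    (hg : g ∈ relSet φ n m) (hh : h ∈ relSet φ p q) :
    mul g h hgh ∈ relSet φ (n + (p - m)) (q + (m - p)) := by
  have h1 := hg.2
  have h2 := hh.2
  rw [hgh] at h1
  refine ⟨?_, ?_⟩
  · simp only [mul, hg.1, hh.1]
    rcases le_total m p with hmp | hmp
    · rw [Nat.sub_eq_zero_of_le hmp]
      push_cast [hmp]
      ring
    · rw [Nat.sub_eq_zero_of_le hmp]
      push_cast [hmp]
      ring
  · rcases le_total m p with hmp | hmp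
    · obtain ⟨j, rfl⟩ := Nat.exists_eq_add_of_le hmp
      have h3 := h1.add h2.1
      simp only [Nat.add_sub_cancel_left, Nat.sub_eq_zero_of_le hmp, Nat.add_zero]
      exact ⟨h3.1, h2.2.1, h3.2.2.trans h2.2.2⟩
    · obtain ⟨j, rfl⟩ := Nat.exists_eq_add_of_le hmp
      have h3 := (h2.symm.add h1.2.1).symm
      simp only [Nat.add_sub_cancel_left, Nat.sub_eq_zero_of_le hmp, Nat.add_zero]
      exact ⟨h1.1, h3.2.1, h1.2.2.trans h3.2.2⟩

theorem tendsto_mul {ι : Type*} {l : Filter ι} {f k : ι → φ.Gpd} {g h : φ.Gpd}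
    (hf : Tendsto f l (𝓝 g)) (hk : Tendsto k l (𝓝 h)) (hfk : ∀ i, (f i).src = (k i).rng)
    (hgh : g.src = h.rng) : Tendsto (fun i => mul (f i) (k i) (hfk i)) l (𝓝 (mul g h hgh)) := by
  obtain ⟨n, m, hg⟩ := g.exists_mem_relSet
  obtain ⟨p, q, hh⟩ := h.exists_mem_relSet
  have h1 := (continuous_rng.tendsto g).comp hf
  have h2 := (continuous_src.tendsto h).comp hk
  refine tendsto_nhds (mul_mem_relSet hgh hg hh) h1 h2 ?_
  filter_upwards [hf ((isOpen_relSet n m).mem_nhds hg), hk ((isOpen_relSet p q).mem_nhds hh)]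
    with i hi hi'
  exact mul_mem_relSet _ hi hi'

theorem continuous_unit : Continuous (unit φ) := by
  refine continuous_iff_continuousAt.2 fun x => ?_
  have h : ∀ x, unit φ x ∈ relSet φ 0 0 := fun x =>
    ⟨by simp [unit], fun i hi => by omega, fun i hi => by omega, rfl⟩
  exact tendsto_nhds (h x) tendsto_id tendsto_id (Eventually.of_forall h)

theorem range_unit : range (unit φ) = relSet φ 0 0 := by
  ext g
  constructor
  · rintro ⟨x, rfl⟩
    exact ⟨by simp [unit], fun i hi => by omega, fun i hi => by omega, rfl⟩
  · intro h
    refine ⟨g.rng, Gpd.ext rfl ?_ ?_⟩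
    · simpa [unit] using h.1.symm
    · exact h.2.2.2

theorem isClopen_range_unit [T2Space X] : IsClopen (range (unit φ)) := by
  refine ⟨?_, by rw [range_unit]; exact isOpen_relSet 0 0⟩
  have : range (unit φ) = {g | g.deg = 0} ∩ {g | g.rng = g.src} := by
    ext g
    constructor
    · rintro ⟨x, rfl⟩
      exact ⟨rfl, rfl⟩
    · rintro ⟨h1, h2⟩
      exact ⟨g.rng, Gpd.ext rfl h1.symm h2⟩
  rw [this]
  exact (isClosed_eq continuous_deg continuous_const).inter
    (isClosed_eq continuous_rng continuous_src)

/-- With `φⁿ` invertible near the range, the equation `φⁿ(x) = φᵐ(y)` determines `x` from `y`. These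
local sections make the source map open and let sums over fibres be followed from one fibre to the
next. -/
theorem exists_section (g : φ.Gpd) : ∃ σ : X → φ.Gpd, Tendsto σ (𝓝 g.src) (𝓝 g) ∧
    ∀ᶠ y in 𝓝 g.src, (σ y).src = y := by
  classical
  obtain ⟨n, m, hg⟩ := g.exists_mem_relSet
  obtain ⟨e, hge, he⟩ := isLocalHomeomorphOn_iterate n g.rng hg.2.1
  let p : X → φ.Gpd → Prop := fun y ξ => ξ ∈ relSet φ n m ∧ ξ.src = y ∧
    ξ.rng = e.symm (φ.toFun^[m] y)
  -- The default value `g` is taken only away from a neighbourhood of `g.src`.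
  let σ : X → φ.Gpd := fun y => if h : ∃ ξ, p y ξ then h.choose else g
  have hsymm : e.symm (φ.toFun^[m] g.src) = g.rng := by
    rw [← hg.2.2.2, he, e.left_inv hge]
  have htgt : φ.toFun^[m] g.src ∈ e.target := by
    rw [← hg.2.2.2, he]
    exact e.map_source hge
  have hcm := continuousAt_iterate hg.2.2.1
  have hct : Tendsto (fun y => e.symm (φ.toFun^[m] y)) (𝓝 g.src) (𝓝 g.rng) := by
    rw [← hsymm]
    exact (e.continuousAt_symm htgt).tendsto.comp hcm
  have hσ : ∀ᶠ y in 𝓝 g.src, p y (σ y) := by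
    filter_upwards [hcm (e.open_target.mem_nhds htgt),
      hct ((isOpen_iterDom n).mem_nhds hg.2.1),
      (isOpen_iterDom m).mem_nhds hg.2.2.1] with y hy1 hy2 hy3
    have hr : φ.Rel n m (e.symm (φ.toFun^[m] y)) y :=
      ⟨hy2, hy3, by rw [he]; exact e.right_inv hy1⟩
    have hex : ∃ ξ, p y ξ :=
      ⟨⟨_, (n : ℤ) - m, y, n, m, rfl, hr⟩, ⟨rfl, hr⟩, rfl, rfl⟩
    simp only [σ, dif_pos hex]
    exact hex.choose_spec
  refine ⟨σ, tendsto_nhds hg (hct.congr' ?_) (tendsto_id.congr' ?_) ?_, ?_⟩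
  · filter_upwards [hσ] with y hy using hy.2.2.symm
  · filter_upwards [hσ] with y hy using hy.2.1.symm
  · filter_upwards [hσ] with y hy using hy.1
  · filter_upwards [hσ] with y hy using hy.2.1

theorem isOpenMap_src : IsOpenMap (Gpd.src : φ.Gpd → X) := by
  refine IsOpenMap.of_nhds_le fun g => ?_
  obtain ⟨σ, hσ, hs⟩ := g.exists_section
  calc 𝓝 g.src = map (fun y => y) (𝓝 g.src) := map_id.symm
    _ = map (fun y => (σ y).src) (𝓝 g.src) := map_congr (hs.mono fun y hy => hy.symm)
    _ = map Gpd.src (map σ (𝓝 g.src)) := by rw [Filter.map_map]; rfl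
    _ ≤ map Gpd.src (𝓝 g) := map_mono hσ

instance [T2Space X] [LocallyCompactSpace X] : LocallyCompactSpace φ.Gpd := by
  have : WeaklyLocallyCompactSpace φ.Gpd := ⟨fun g => by
    obtain ⟨B, hB, hgB, -, hBs⟩ := exists_bisection g
    have hemb : IsOpenEmbedding (B.domRestrict Gpd.src) :=
      .of_continuous_injective_isOpenMap (continuous_src.comp continuous_subtype_val)
        (injOn_iff_injective.1 hBs) (isOpenMap_src.domRestrict hB)
    have := hemb.locallyCompactSpace
    obtain ⟨K, hK, hKn⟩ := exists_compact_mem_nhds (⟨g, hgB⟩ : B)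
    exact ⟨_, hK.image continuous_subtype_val, hB.isOpenMap_subtype_val.image_mem_nhds hKn⟩⟩
  infer_instance

/-- Functions in `C_c(G)` with support in a prescribed neighbourhood of a point. -/
theorem exists_bump [T2Space X] [LocallyCompactSpace X] (g : φ.Gpd) {O : Set φ.Gpd}
    (hO : IsOpen O) (hg : g ∈ O) : ∃ f : C_c(φ.Gpd, ℂ), f g = 1 ∧ ∀ h, f h ≠ 0 → h ∈ O := by
  obtain ⟨f, hf1, hf0, hfc, -⟩ := exists_continuous_one_zero_of_isCompact
    (isCompact_singleton (x := g)) hO.isClosed_compl (disjoint_compl_right_iff_subset.2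
      (singleton_subset_iff.2 hg))
  refine ⟨⟨⟨fun h => (f h : ℂ), by fun_prop⟩, hfc.comp_left (g := fun r : ℝ => (r : ℂ)) (by simp)⟩,
    ?_, fun h hh => ?_⟩
  · simpa using hf1 (mem_singleton g)
  · by_contra hhO
    exact hh (by simpa using hf0 hhO)

end Gpd

end PartialLocalHomeo

/-! ## The convolution algebra -/

namespace PartialLocalHomeo

variable {X : Type*} [TopologicalSpace X] {φ : PartialLocalHomeo X}

namespace Gpd

open Classical in
/-- `g h⁻¹` if `g` and `h` have the same source, and `g` otherwise. -/
noncomputable def gdiv (g h : φ.Gpd) : φ.Gpd :=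
  if e : g.src = h.src then mul g (inv h) e else g

theorem gdiv_eq {g h : φ.Gpd} (e : g.src = h.src) : gdiv g h = mul g (inv h) e := dif_pos e

theorem Fiber.div_eq {x : X} (g h : Fiber φ x) : g.div h = gdiv g.1 h.1 :=
  (gdiv_eq (g.2.trans h.2.symm)).symm

theorem gdiv_unit (g : φ.Gpd) : gdiv g (unit φ g.src) = g := by
  rw [gdiv_eq (show g.src = (unit φ g.src).src from rfl)]
  exact Gpd.ext rfl (by simp [mul, inv, unit]) rfl

theorem mul_gdiv {g h : φ.Gpd} (e : g.src = h.src) (e' : (gdiv g h).src = h.rng) :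
    mul (gdiv g h) h e' = g := by
  refine Gpd.ext ?_ ?_ e.symm
  · simp [gdiv_eq e, mul]
  · simp [gdiv_eq e, mul, inv]

theorem gdiv_src {g h : φ.Gpd} (e : g.src = h.src) : (gdiv g h).src = h.rng := by
  rw [gdiv_eq e]
  rfl

theorem tendsto_gdiv {ι : Type*} {l : Filter ι} {f k : ι → φ.Gpd} {g h : φ.Gpd}
    (hf : Tendsto f l (𝓝 g)) (hk : Tendsto k l (𝓝 h)) (hfk : ∀ᶠ i in l, (f i).src = (k i).src)
    (hgh : g.src = h.src) : Tendsto (fun i => gdiv (f i) (k i)) l (𝓝 (gdiv g h)) := by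
  obtain ⟨n, m, hg⟩ := g.exists_mem_relSet
  obtain ⟨p, q, hh⟩ := (inv h).exists_mem_relSet
  have hki := (continuous_inv.tendsto h).comp hk
  have h1 := (continuous_rng.tendsto g).comp hf
  have h2 := (continuous_src.tendsto _).comp hki
  rw [gdiv_eq hgh]
  refine tendsto_nhds (mul_mem_relSet hgh hg hh) (h1.congr' ?_) (h2.congr' ?_) ?_
  · filter_upwards [hfk] with i hi
    rw [gdiv_eq hi]
    rfl
  · filter_upwards [hfk] with i hi
    rw [gdiv_eq hi]
    rfl
  · filter_upwards [hfk, hf ((isOpen_relSet n m).mem_nhds hg),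
      hki ((isOpen_relSet p q).mem_nhds hh)] with i hi hi1 hi2
    rw [gdiv_eq hi]
    exact mul_mem_relSet _ hi1 hi2

end Gpd

/-- An element of the groupoid as an element of the fibre over its source. -/
def Gpd.Fiber.self (g : φ.Gpd) : Fiber φ g.src := ⟨g, rfl⟩

open Gpd

/-- The convolution product of two functions on the groupoid. -/
noncomputable def convFun (f k : φ.Gpd → ℂ) (g : φ.Gpd) : ℂ :=
  ∑' h : Fiber φ g.src, f (gdiv g h.1) * k h.1

/-- Only the finite set `S` of points of `tsupport k` over `g.src` contributes at `g`. Local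
sections carry these points to nearby fibres and there exhaust the support, so the convolution is
locally a finite sum of terms continuous at `g`. -/
theorem continuous_convFun [T2Space X] (f k : C_c(φ.Gpd, ℂ)) : Continuous (convFun f k) := by
  classical
  refine continuous_iff_continuousAt.2 fun g => ?_
  have hK : IsCompact (tsupport k) := k.hasCompactSupport.isCompact
  obtain ⟨N, -, hN⟩ := exists_card_bound hK
  have hS : {h | h ∈ tsupport k ∧ h.src = g.src}.Finite :=
    BandMatrix.finite_of_card_le fun s hs => hN g.src s hs
  set S := {h | h ∈ tsupport k ∧ h.src = g.src} with hSdef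
  obtain ⟨U, hU, hUd⟩ := hS.t2_separation
  choose B hBo hB hBr hBs using (exists_bisection : ∀ g : φ.Gpd, _)
  choose σ hσ hσs using (exists_section : ∀ g : φ.Gpd, _)
  have : Fintype S := hS.fintype
  -- The rest of the support is compact with image missing `g.src`, hence missing all nearby
  -- sources.
  have hC : IsCompact (tsupport k \ ⋃ h ∈ S, (U h ∩ B h)) :=
    hK.diff (isOpen_biUnion fun h _ => (hU h).2.inter (hBo h))
  have hg : g.src ∉ Gpd.src '' (tsupport k \ ⋃ h ∈ S, (U h ∩ B h)) := by
    rintro ⟨h, ⟨hh, hh'⟩, hs⟩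
    exact hh' (mem_biUnion (show h ∈ S from ⟨hh, hs⟩) ⟨(hU h).1, hB h⟩)
  have hev1 : ∀ᶠ g' in 𝓝 g, g'.src ∉ Gpd.src '' (tsupport k \ ⋃ h ∈ S, (U h ∩ B h)) :=
    (continuous_src.tendsto g) ((hC.image continuous_src).isClosed.isOpen_compl.mem_nhds hg)
  have hσ' : ∀ h : S, Tendsto (fun g' : φ.Gpd => σ h.1 g'.src) (𝓝 g) (𝓝 h.1) := fun h => by
    have := (hσ h.1)
    rw [h.2.2] at this
    exact this.comp (continuous_src.tendsto g)
  have hσs' : ∀ h : S, ∀ᶠ g' in 𝓝 g, (σ h.1 g'.src).src = g'.src := fun h => by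
    have := (hσs h.1)
    rw [h.2.2] at this
    exact (continuous_src.tendsto g) this
  have hev2 : ∀ᶠ g' in 𝓝 g, ∀ h : S, σ h.1 g'.src ∈ U h.1 ∩ B h.1 ∧ (σ h.1 g'.src).src = g'.src :=
    eventually_all.2 fun h => ((hσ' h).eventually_mem
      (((hU h).2.inter (hBo h)).mem_nhds ⟨(hU h).1, hB h⟩)).and (hσs' h)
  have hev : ∀ᶠ g' in 𝓝 g, convFun f k g' =
      ∑ h : S, f (gdiv g' (σ h.1 g'.src)) * k (σ h.1 g'.src) := by
    filter_upwards [hev1, hev2] with g' h1 h2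
    let τ : S → Fiber φ g'.src := fun h => ⟨σ h.1 g'.src, (h2 h).2⟩
    have hτ : Function.Injective τ := fun a b hab => by
      by_contra hne
      have := hUd a.2 b.2 (fun h => hne (Subtype.ext h))
      have hab' : σ a.1 g'.src = σ b.1 g'.src := congrArg Subtype.val hab
      exact disjoint_left.1 this (h2 a).1.1 (hab' ▸ (h2 b).1.1)
    have := hτ.tsum_eq (f := fun h : Fiber φ g'.src => f (gdiv g' h.1) * k h.1) (fun h hh => by
      have hk : k h.1 ≠ 0 := right_ne_zero_of_mul hh
      have hm : h.1 ∈ ⋃ h ∈ S, (U h ∩ B h) := by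
        by_contra hm
        exact h1 ⟨h.1, ⟨subset_tsupport _ hk, hm⟩, h.2⟩
      obtain ⟨s, hs, hsU⟩ := mem_iUnion₂.1 hm
      refine ⟨⟨s, hs⟩, Subtype.ext (hBs s (h2 ⟨s, hs⟩).1.2 hsU.2 ?_)⟩
      exact (h2 ⟨s, hs⟩).2.trans h.2.symm)
    rw [convFun, ← this, tsum_fintype]
  have hval := hev.self_of_nhds
  rw [ContinuousAt, hval]
  refine Tendsto.congr' (hev.mono fun _ h => h.symm) ?_
  refine tendsto_finsetSum _ fun h _ => ?_
  -- Convergence along `𝓝 g` includes the point `g` itself, so limits being unique pins the value of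
  -- the section there.
  have hh0 : σ h.1 g.src = h.1 :=
    (tendsto_nhds_unique (tendsto_pure_nhds _ g) ((hσ' h).mono_left (pure_le_nhds g)) :)
  rw [hh0]
  exact ((f.continuous.tendsto _).comp (tendsto_gdiv tendsto_id (hσ' h)
    ((hσs' h).mono fun _ h => h.symm) h.2.2.symm)).mul ((k.continuous.tendsto _).comp (hσ' h))

/-- The support lies in the image under multiplication of the composable pairs in the product of the
two supports. Such pairs form a closed set because `X` is Hausdorff. -/
theorem hasCompactSupport_convFun [T2Space X] (f k : C_c(φ.Gpd, ℂ)) :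
    HasCompactSupport (convFun f k) := by
  have hcl : IsClosed {p : φ.Gpd × φ.Gpd | p.1.src = p.2.rng} :=
    isClosed_eq (continuous_src.comp continuous_fst) (continuous_rng.comp continuous_snd)
  let M : {p : φ.Gpd × φ.Gpd | p.1.src = p.2.rng} → φ.Gpd := fun p => mul p.1.1 p.1.2 p.2
  have hM : Continuous M := continuous_iff_continuousAt.2 fun p =>
    tendsto_mul ((continuous_fst.comp continuous_subtype_val).tendsto p)
      ((continuous_snd.comp continuous_subtype_val).tendsto p) (fun p => p.2) p.2
  have hc := hcl.isClosedEmbedding_subtypeVal.isCompact_preimage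
    (f.hasCompactSupport.isCompact.prod k.hasCompactSupport.isCompact)
  refine HasCompactSupport.intro (hc.image hM) fun g hg => ?_
  rw [convFun]
  refine (tsum_congr fun h => ?_).trans tsum_zero
  by_contra hne
  have e : g.src = h.1.src := h.2.symm
  exact hg ⟨⟨(gdiv g h.1, h.1), gdiv_src e⟩, ⟨subset_tsupport _ (left_ne_zero_of_mul hne),
    subset_tsupport _ (right_ne_zero_of_mul hne)⟩, mul_gdiv e _⟩

/-- The convolution product on `C_c(G)`. -/
noncomputable def conv [T2Space X] (f k : C_c(φ.Gpd, ℂ)) : C_c(φ.Gpd, ℂ) :=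
  ⟨⟨convFun f k, continuous_convFun f k⟩, hasCompactSupport_convFun f k⟩

theorem conv_apply [T2Space X] (f k : C_c(φ.Gpd, ℂ)) (g : φ.Gpd) :
    conv f k g = ∑' h : Fiber φ g.src, f (gdiv g h.1) * k h.1 := rfl

/-- The involution on `C_c(G)`. -/
noncomputable def invol (f : C_c(φ.Gpd, ℂ)) : C_c(φ.Gpd, ℂ) :=
  ⟨⟨fun g => star (f (inv g)), continuous_star.comp (f.continuous.comp continuous_inv)⟩, by
    have h : HasCompactSupport fun g => f (inv g) :=
      f.hasCompactSupport.comp_homeomorph ⟨⟨inv, inv, inv_inv, inv_inv⟩, continuous_inv,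
        continuous_inv⟩
    exact h.comp_left (g := fun z : ℂ => star z) (star_zero ℂ)⟩

theorem invol_apply (f : C_c(φ.Gpd, ℂ)) (g : φ.Gpd) : invol f g = star (f (inv g)) := rfl

/-! ## Matrix coefficients of the regular representations -/

open Classical in
/-- The canonical basis vectors of `ℓ²(G_x)`. -/
noncomputable def delta {x : X} (h : Fiber φ x) : ℓ²(Fiber φ x, ℂ) := lp.single 2 h 1

theorem delta_self {x : X} (h : Fiber φ x) : delta h h = 1 := by
  classical
  exact lp.single_apply_self _ _ _

theorem delta_ne {x : X} {h g : Fiber φ x} (hg : g ≠ h) : delta h g = 0 := by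
  classical
  exact lp.single_apply_ne _ _ _ hg

theorem norm_delta {x : X} (h : Fiber φ x) : ‖delta h‖ = 1 := by
  classical
  rw [delta, lp.norm_single (by norm_num), norm_one]

theorem eq_of_delta {x : X} {S T : ℓ²(Fiber φ x, ℂ) →L[ℂ] ℓ²(Fiber φ x, ℂ)}
    (h : ∀ k g, S (delta k) g = T (delta k) g) : S = T := by
  classical
  refine lp.ext_continuousLinearMap (ENNReal.ofNat_ne_top (n := 2)) fun i => ?_
  refine ContinuousLinearMap.ext_ring ?_
  refine lp.ext (funext fun g => ?_)
  exact h i g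

theorem regRep_delta (f : C_c(φ.Gpd, ℂ)) {x : X} (h g : Fiber φ x) :
    regRep f x (delta h) g = f (g.div h) := by
  rw [regRep_apply, tsum_eq_single h]
  · rw [delta_self, mul_one]
  · intro k hk
    rw [delta_ne hk, mul_zero]

theorem rep_mul (a b : ReducedCStar φ) (x : X) : rep (a * b) x = rep a x * rep b x := rfl

theorem rep_star (a : ReducedCStar φ) (x : X) : rep (star a) x = star (rep a x) := rfl

theorem ext_rep {a b : ReducedCStar φ} (h : ∀ x, rep a x = rep b x) : a = b := by
  refine Subtype.ext ?_
  refine lp.ext (E := fun x : X => ℓ²(Fiber φ x, ℂ) →L[ℂ] ℓ²(Fiber φ x, ℂ)) (funext h)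

theorem ofCc_add (f k : C_c(φ.Gpd, ℂ)) : ofCc (f + k) = ofCc f + ofCc k :=
  ext_rep fun x => eq_of_delta fun h g => by
    change regRep (f + k) x (delta h) g = regRep f x (delta h) g + regRep k x (delta h) g
    simp only [regRep_delta]
    rfl

theorem ofCc_smul (c : ℂ) (f : C_c(φ.Gpd, ℂ)) : ofCc (c • f) = c • ofCc f :=
  ext_rep fun x => eq_of_delta fun h g => by
    change regRep (c • f) x (delta h) g = c * regRep f x (delta h) g
    simp only [regRep_delta]
    rfl

theorem inner_delta {x : X} (h : Fiber φ x) (v : ℓ²(Fiber φ x, ℂ)) :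
    inner ℂ (delta h) v = v h := by
  classical
  rw [delta, lp.inner_single_left]
  simp

theorem inner_delta_right {x : X} (h : Fiber φ x) (v : ℓ²(Fiber φ x, ℂ)) :
    inner ℂ v (delta h) = star (v h) := by
  rw [← inner_conj_symm, inner_delta]
  rfl

theorem star_apply_delta {x : X} (T : ℓ²(Fiber φ x, ℂ) →L[ℂ] ℓ²(Fiber φ x, ℂ))
    (h g : Fiber φ x) : (star T) (delta h) g = star (T (delta g) h) := by
  rw [← inner_delta, ContinuousLinearMap.star_eq_adjoint, ContinuousLinearMap.adjoint_inner_right,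
    inner_delta_right]

theorem ofCc_invol (f : C_c(φ.Gpd, ℂ)) : ofCc (invol f) = star (ofCc f) :=
  ext_rep fun x => eq_of_delta fun h g => by
    rw [rep_star, star_apply_delta, rep_ofCc, rep_ofCc, regRep_delta, regRep_delta, invol_apply]
    congr 2
    exact Gpd.ext rfl (by simp [Fiber.div, mul, inv]) rfl

/-- Right translation by `h⁻¹`, from the fibre of `h` over its source to the fibre over its
range. -/
def Gpd.Fiber.divEquiv {x : X} (h : Fiber φ x) : Fiber φ x ≃ Fiber φ h.1.rng where
  toFun g := ⟨g.div h, rfl⟩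
  invFun g := ⟨mul g.1 h.1 g.2, h.2⟩
  left_inv g := Subtype.ext (Gpd.ext rfl (by simp [Fiber.div, mul, inv]) (h.2.trans g.2.symm))
  right_inv g := Subtype.ext (Gpd.ext rfl (by simp [Fiber.div, mul, inv]) g.2.symm)

theorem ofCc_conv [T2Space X] (f k : C_c(φ.Gpd, ℂ)) : ofCc (conv f k) = ofCc f * ofCc k :=
  ext_rep fun x => eq_of_delta fun h g => by
    rw [rep_mul, mul_apply_eq_comp, rep_ofCc, rep_ofCc, rep_ofCc, regRep_delta,
      regRep_apply, conv_apply]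
    refine ((Gpd.Fiber.divEquiv h).tsum_eq
      fun l : Fiber φ h.1.rng => f (gdiv (g.div h) l.1) * k l.1).symm.trans ?_
    refine tsum_congr fun l => ?_
    rw [regRep_delta]
    change f (gdiv (g.div h) (l.div h)) * k (l.div h) = _
    congr 2
    rw [gdiv_eq (show (g.div h).src = (l.div h).src from rfl)]
    exact Gpd.ext rfl (by simp [Fiber.div, mul, inv]) rfl

/-- Convolution and involution make the image of $C_c$ a `*`-subalgebra already, so `adjoin` adds
nothing before the closure is taken. -/
theorem denseRange_ofCc [T2Space X] : DenseRange (ofCc (φ := φ)) := by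
  have hle : NonUnitalStarAlgebra.adjoin ℂ (Set.range (regRepFamily (φ := φ))) ≤
      { carrier := Set.range (regRepFamily (φ := φ))
        zero_mem' := ⟨0, by
          have h := ofCc_smul (φ := φ) 0 0
          rw [zero_smul, zero_smul] at h
          exact congrArg Subtype.val h⟩
        add_mem' := by
          rintro _ _ ⟨f, rfl⟩ ⟨k, rfl⟩
          exact ⟨f + k, congrArg Subtype.val (ofCc_add f k)⟩
        mul_mem' := by
          rintro _ _ ⟨f, rfl⟩ ⟨k, rfl⟩
          exact ⟨conv f k, congrArg Subtype.val (ofCc_conv f k)⟩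
        smul_mem' := by
          rintro c _ ⟨f, rfl⟩
          exact ⟨c • f, congrArg Subtype.val (ofCc_smul c f)⟩
        star_mem' := by
          rintro _ ⟨f, rfl⟩
          exact ⟨invol f, congrArg Subtype.val (ofCc_invol f)⟩ } :=
    NonUnitalStarAlgebra.adjoin_le Subset.rfl
  rintro (a : reducedSubalgebra φ)
  have h1 : a.1 ∈ closure (Set.range (regRepFamily (φ := φ))) :=
    closure_mono hle (show a.1 ∈ closure _ from a.2)
  let e : C_c(φ.Gpd, ℂ) → reducedSubalgebra φ := ofCc
  have h2 : a ∈ closure (Set.range e) := by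
    rw [closure_subtype, ← Set.range_comp]
    exact h1
  exact h2

theorem ofCc_induction [T2Space X] {p : ReducedCStar φ → Prop} (hp : IsClosed {a | p a})
    (h : ∀ f, p (ofCc f)) (a : ReducedCStar φ) : p a :=
  isClosed_property denseRange_ofCc hp h a

/-- The function on the groupoid represented by an element of the reduced C*-algebra. -/
noncomputable def coeff (a : ReducedCStar φ) (g : φ.Gpd) : ℂ :=
  rep a g.src (delta (Fiber.unit φ g.src)) (Fiber.self g)

theorem condExp_eq_coeff (a : ReducedCStar φ) (x : X) : condExp a x = coeff a (unit φ x) := rfl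

theorem norm_rep_apply_le (a : ReducedCStar φ) {x : X} (v : ℓ²(Fiber φ x, ℂ)) (g : Fiber φ x) :
    ‖rep a x v g‖ ≤ ‖a‖ * ‖v‖ :=
  calc ‖rep a x v g‖ ≤ ‖rep a x v‖ := lp.norm_apply_le_norm (by norm_num) _ _
    _ ≤ ‖rep a x‖ * ‖v‖ := (rep a x).le_opNorm _
    _ ≤ ‖a‖ * ‖v‖ := by gcongr; exact norm_rep_le a x

theorem continuous_rep_apply {x : X} (v : ℓ²(Fiber φ x, ℂ)) (g : Fiber φ x) :
    Continuous fun a : ReducedCStar φ => rep a x v g := by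
  refine (LipschitzWith.of_dist_le_mul (K := ‖v‖₊) fun a b => ?_).continuous
  rw [dist_eq_norm, dist_eq_norm, mul_comm]
  exact norm_rep_apply_le (a - b) v g

theorem coeff_sub (a b : ReducedCStar φ) (g : φ.Gpd) : coeff (a - b) g = coeff a g - coeff b g :=
  rfl

theorem coeff_smul (c : ℂ) (a : ReducedCStar φ) (g : φ.Gpd) : coeff (c • a) g = c * coeff a g :=
  rfl

theorem norm_coeff_le (a : ReducedCStar φ) (g : φ.Gpd) : ‖coeff a g‖ ≤ ‖a‖ := by
  have := norm_rep_apply_le a (delta (Fiber.unit φ g.src)) (Fiber.self g)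
  rwa [norm_delta, mul_one] at this

theorem continuous_coeff_left (g : φ.Gpd) : Continuous fun a : ReducedCStar φ => coeff a g :=
  continuous_rep_apply _ _

theorem coeff_ofCc (f : C_c(φ.Gpd, ℂ)) (g : φ.Gpd) : coeff (ofCc f) g = f g := by
  refine (regRep_delta f _ (Fiber.self g)).trans ?_
  rw [Fiber.div_eq]
  exact congrArg f (gdiv_unit g)

/-- Every matrix entry of every `π_x(a)` is a value of `coeff a`, which is why the function `coeff
a` determines `a`. -/
theorem rep_delta [T2Space X] (a : ReducedCStar φ) {x : X} (h g : Fiber φ x) :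
    rep a x (delta h) g = coeff a (g.div h) := by
  refine ofCc_induction (p := fun a => rep a x (delta h) g = coeff a (g.div h))
    (isClosed_eq (continuous_rep_apply _ _) (continuous_coeff_left _)) (fun f => ?_) a
  rw [rep_ofCc, regRep_delta, coeff_ofCc]

theorem coeff_injective [T2Space X] : Function.Injective (coeff (φ := φ)) := fun a b hab =>
  ext_rep fun x => eq_of_delta fun h g => by rw [rep_delta, rep_delta, hab]

theorem exists_norm_sub_ofCc_lt [T2Space X] (a : ReducedCStar φ) {ε : ℝ} (hε : 0 < ε) :
    ∃ f : C_c(φ.Gpd, ℂ), ‖a - ofCc f‖ < ε := by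
  obtain ⟨f, hf⟩ := denseRange_ofCc.exists_dist_lt a hε
  exact ⟨f, by rwa [← dist_eq_norm]⟩

theorem continuous_coeff [T2Space X] (a : ReducedCStar φ) : Continuous (coeff a) := by
  refine continuous_of_uniform_approx_of_continuous fun u hu => ?_
  obtain ⟨ε, hε, hεu⟩ := Metric.mem_uniformity_dist.1 hu
  obtain ⟨f, hf⟩ := exists_norm_sub_ofCc_lt a hε
  refine ⟨f, f.continuous, fun g => hεu ?_⟩
  rw [dist_eq_norm, ← coeff_ofCc f g, ← coeff_sub]
  exact (norm_coeff_le _ _).trans_lt hf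

theorem continuous_condExp [T2Space X] (a : ReducedCStar φ) : Continuous (condExp a) :=
  (continuous_coeff a).comp continuous_unit

theorem condExp_star_mul (a b : ReducedCStar φ) (x : X) :
    condExp (star a * b) x =
      inner ℂ (rep a x (delta (Fiber.unit φ x))) (rep b x (delta (Fiber.unit φ x))) := by
  change rep (star a * b) x (delta (Fiber.unit φ x)) (Fiber.unit φ x) = _
  rw [rep_mul, ← inner_delta, mul_apply_eq_comp, rep_star,
    ContinuousLinearMap.star_eq_adjoint, ContinuousLinearMap.adjoint_inner_right]

theorem condExp_star_mul_self (a : ReducedCStar φ) (x : X) :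
    condExp (star a * a) x = ((‖rep a x (delta (Fiber.unit φ x))‖ ^ 2 : ℝ) : ℂ) := by
  rw [condExp_star_mul, inner_self_eq_norm_sq_to_K]
  push_cast
  rfl

theorem eq_zero_of_condExp_star_mul_self [T2Space X] {a : ReducedCStar φ}
    (h : ∀ x, condExp (star a * a) x = 0) : a = 0 := by
  refine coeff_injective (funext fun g => ?_)
  have := h g.src
  rw [condExp_star_mul_self] at this
  have h0 : rep a g.src (delta (Fiber.unit φ g.src)) = 0 := by
    simpa using this
  rw [coeff, h0]
  rfl

/-- When the support is a bisection, each matrix of `π_x(f)` has at most one non-zero entry in every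
row and column, so the band bound applies with `N = 1`. -/
theorem norm_ofCc_le [T2Space X] {f : C_c(φ.Gpd, ℂ)} {C : ℝ} (hC : 0 ≤ C) (hf : ∀ g, ‖f g‖ ≤ C)
    (hr : InjOn Gpd.rng {g | f g ≠ 0}) (hs : InjOn Gpd.src {g | f g ≠ 0}) : ‖ofCc f‖ ≤ C := by
  have hk : ∀ x, BandMatrix.IsBand (fun g h : Fiber φ x => f (g.div h)) 1 C := fun x => by
    refine ⟨fun g h => hf _, fun g s hs => ?_, fun h s hs' => ?_⟩
    · refine Finset.card_le_one.2 fun a ha b hb => ?_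
      have hab := hr (hs a ha) (hs b hb) rfl
      have h1 := congrArg Gpd.deg hab
      have h2 := congrArg Gpd.src hab
      simp only [Fiber.div, mul, inv] at h1 h2
      exact Subtype.ext (Gpd.ext h2 (by omega) (a.2.trans b.2.symm))
    · refine Finset.card_le_one.2 fun a ha b hb => ?_
      have hab := hs (hs' a ha) (hs' b hb) rfl
      have h1 := congrArg Gpd.deg hab
      have h2 := congrArg Gpd.rng hab
      simp only [Fiber.div, mul, inv] at h1 h2
      exact Subtype.ext (Gpd.ext h2 (by omega) (a.2.trans b.2.symm))
  refine lp.norm_le_of_forall_le (E := fun x : X => ℓ²(Fiber φ x, ℂ) →L[ℂ] ℓ²(Fiber φ x, ℂ)) hC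
    fun x => ?_
  -- The operator depends on the kernel alone, so the constants chosen in `regRep` may be replaced.
  have h1 : regRep f x = BandMatrix.toCLM _ 1 C hC (hk x) :=
    ContinuousLinearMap.ext fun ψ => lp.ext (funext fun g => rfl)
  change ‖regRep f x‖ ≤ C
  rw [h1]
  simpa using BandMatrix.norm_toCLM_le hC (hk x)

/-! ## The diagonal -/

open Classical in
/-- A function in `C_c(X)` as a function on the groupoid, supported on the units. -/
noncomputable def diag [T2Space X] (f : C_c(X, ℂ)) : C_c(φ.Gpd, ℂ) :=
  ⟨⟨fun g => if g ∈ range (unit φ) then f g.rng else 0,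
    (f.continuous.comp continuous_rng).if (fun g hg => by
      have h : g ∈ frontier (range (Gpd.unit φ)) := hg
      rw [isClopen_range_unit.frontier_eq] at h
      exact h.elim) continuous_const⟩, by
    refine HasCompactSupport.intro (f.hasCompactSupport.isCompact.image continuous_unit)
      fun g hg => ?_
    by_cases h : g ∈ range (unit φ)
    · obtain ⟨x, rfl⟩ := h
      have : f x = 0 := by
        by_contra hx
        exact hg ⟨x, subset_tsupport _ hx, rfl⟩
      simp [this, Gpd.unit]
    · simp [h]⟩

theorem diag_unit [T2Space X] (f : C_c(X, ℂ)) (x : X) : diag f (unit φ x) = f x :=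
  if_pos ⟨x, rfl⟩

theorem diag_of_notMem [T2Space X] (f : C_c(X, ℂ)) {g : φ.Gpd} (hg : g ∉ range (unit φ)) :
    diag f g = 0 := if_neg hg

theorem regRep_diag [T2Space X] (f : C_c(X, ℂ)) {x : X} (ψ : ℓ²(Fiber φ x, ℂ)) (g : Fiber φ x) :
    regRep (diag f) x ψ g = f g.1.rng * ψ g := by
  rw [regRep_apply, tsum_eq_single g]
  · congr 1
    rw [← diag_unit (φ := φ) f g.1.rng]
    congr 1
    exact Gpd.ext rfl (by simp [Fiber.div, mul, inv, Gpd.unit]) rfl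
  · intro h hh
    rw [diag_of_notMem, zero_mul]
    rintro ⟨y, hy⟩
    refine hh (Subtype.ext (Gpd.ext ?_ ?_ (h.2.trans g.2.symm)))
    · have h1 := congrArg Gpd.rng hy
      have h2 := congrArg Gpd.src hy
      exact h2.symm.trans h1
    · have h3 := congrArg Gpd.deg hy
      simp only [Gpd.unit, Fiber.div, mul, inv] at h3
      omega

theorem coeff_diag_mul [T2Space X] (f : C_c(X, ℂ)) (a : ReducedCStar φ) (g : φ.Gpd) :
    coeff (ofCc (diag f) * a) g = f g.rng * coeff a g := by
  exact regRep_diag f (rep a g.src (delta (Fiber.unit φ g.src))) (Fiber.self g)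

theorem coeff_mul_diag [T2Space X] (f : C_c(X, ℂ)) (a : ReducedCStar φ) (g : φ.Gpd) :
    coeff (a * ofCc (diag f)) g = coeff a g * f g.src := by
  have : regRep (diag f) g.src (delta (Fiber.unit φ g.src)) =
      f g.src • delta (Fiber.unit φ g.src) := by
    refine lp.ext (funext fun h => ?_)
    rw [regRep_diag]
    change f h.1.rng * delta (Fiber.unit φ g.src) h = f g.src * delta (Fiber.unit φ g.src) h
    by_cases hh : h = Fiber.unit φ g.src
    · rw [hh]
      rfl
    · rw [delta_ne hh, mul_zero, mul_zero]
  rw [coeff, rep_mul, mul_apply_eq_comp, rep_ofCc, this, map_smul, mul_comm]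
  rfl

end PartialLocalHomeo

/-! ## Diagonal KMS weights -/

theorem KMS.OneParameterGroup.zero_apply {A : Type*} [NonUnitalCStarAlgebra A]
    (α : KMS.OneParameterGroup A) (a : A) : α.toFun 0 a = a := by
  have h := α.map_add 0 0 a
  rw [add_zero] at h
  exact ((α.toFun 0).injective h).symm

theorem star_mul_polarization {A : Type*} [NonUnitalCStarAlgebra A] (a b : A) :
    (4 : ℂ) • (star a * b) = star (a + b) * (a + b) - star (a - b) * (a - b)
      - Complex.I • (star (a + Complex.I • b) * (a + Complex.I • b))
      + Complex.I • (star (a - Complex.I • b) * (a - Complex.I • b)) := by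
  have hI : star Complex.I = -Complex.I := Complex.conj_I
  simp only [star_add, star_sub, star_smul, add_mul, sub_mul, mul_add, mul_sub, smul_mul_assoc,
    mul_smul_comm, smul_add, smul_sub, smul_smul, hI]
  have h1 : Complex.I * -Complex.I = 1 := by simp
  have h2 : Complex.I * Complex.I = -1 := Complex.I_mul_I
  simp only [h1, h2, mul_one, one_smul, neg_smul]
  module

namespace PartialLocalHomeo

variable {X : Type*} [TopologicalSpace X] {φ : PartialLocalHomeo X}

open Gpd

/-- The vector `π_x(a) δ_x`. -/
noncomputable def vec (a : ReducedCStar φ) (x : X) : ℓ²(Fiber φ x, ℂ) :=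
  rep a x (delta (Fiber.unit φ x))

theorem vec_add (a b : ReducedCStar φ) (x : X) : vec (a + b) x = vec a x + vec b x := rfl

theorem vec_smul (c : ℂ) (a : ReducedCStar φ) (x : X) : vec (c • a) x = c • vec a x := rfl

theorem vec_apply (a : ReducedCStar φ) (g : φ.Gpd) : vec a g.src (Fiber.self g) = coeff a g := rfl

theorem condExp_star_mul' (a b : ReducedCStar φ) (x : X) :
    condExp (star a * b) x = inner ℂ (vec a x) (vec b x) := condExp_star_mul a b x

theorem condExp_star_mul_self' (a : ReducedCStar φ) (x : X) :
    condExp (star a * a) x = ((‖vec a x‖ ^ 2 : ℝ) : ℂ) := condExp_star_mul_self a x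

theorem continuous_norm_vec_sq [T2Space X] (a : ReducedCStar φ) :
    Continuous fun x => ‖vec a x‖ ^ 2 := by
  have h := Complex.continuous_re.comp (continuous_condExp (star a * a))
  refine h.congr fun x => ?_
  rw [Function.comp_apply, condExp_star_mul_self', Complex.ofReal_re]

theorem diag_eq_invol [T2Space X] {f : C_c(X, ℂ)} (hf : ∀ x, star (f x) = f x) :
    invol (diag (φ := φ) f) = diag f := by
  ext g
  rw [invol_apply]
  by_cases hg : g ∈ range (Gpd.unit φ)
  · obtain ⟨x, rfl⟩ := hg
    have : Gpd.inv (Gpd.unit φ x) = Gpd.unit φ x := Gpd.ext rfl (by simp [Gpd.inv, Gpd.unit]) rfl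
    rw [this, diag_unit, hf]
  · rw [diag_of_notMem f hg, diag_of_notMem f, star_zero]
    rintro ⟨x, hx⟩
    refine hg ⟨x, ?_⟩
    rw [← inv_inv g, ← hx]
    exact Gpd.ext rfl (by simp [Gpd.inv, Gpd.unit]) rfl

theorem star_mul_self_mem_definitionSpace {ψ : ReducedCStar φ → ℝ≥0∞} {a : ReducedCStar φ} (ha : a ∈ KMS.leftIdeal ψ) :
    star a * a ∈ KMS.definitionSpace ψ := Submodule.subset_span ⟨a, ha, a, ha, rfl⟩

section Weight

variable [MeasurableSpace X] {m : Measure X} {ψ : ReducedCStar φ → ℝ≥0∞}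

theorem weight_star_mul_self (hψ : ∀ a : ReducedCStar φ, 0 ≤ a → ψ a = measureWeight m a)
    (a : ReducedCStar φ) : ψ (star a * a) = ∫⁻ x, ENNReal.ofReal (‖vec a x‖ ^ 2) ∂m := by
  rw [hψ _ (star_mul_self_nonneg a)]
  refine lintegral_congr fun x => ?_
  rw [condExp_star_mul_self', Complex.ofReal_re]

theorem integral_condExp_star_mul_self (a : ReducedCStar φ) :
    ∫ x, condExp (star a * a) x ∂m = ((∫ x, ‖vec a x‖ ^ 2 ∂m : ℝ) : ℂ) := by
  rw [← integral_complex_ofReal]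
  exact integral_congr_ae (Eventually.of_forall fun x => condExp_star_mul_self' a x)

variable [T2Space X] [BorelSpace X]

theorem mem_leftIdeal_iff (hψ : ∀ a : ReducedCStar φ, 0 ≤ a → ψ a = measureWeight m a)
    (a : ReducedCStar φ) : a ∈ KMS.leftIdeal ψ ↔ Integrable (fun x => ‖vec a x‖ ^ 2) m := by
  rw [KMS.leftIdeal, mem_ofPred_eq, weight_star_mul_self hψ, lt_top_iff_ne_top]
  exact lintegral_ofReal_ne_top_iff_integrable (continuous_norm_vec_sq a).aestronglyMeasurable
    (Eventually.of_forall fun x => sq_nonneg _)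

theorem integrable_condExp_star_mul_self
    (hψ : ∀ a : ReducedCStar φ, 0 ≤ a → ψ a = measureWeight m a) {a : ReducedCStar φ}
    (ha : a ∈ KMS.leftIdeal ψ) : Integrable (condExp (star a * a)) m :=
  (((mem_leftIdeal_iff hψ a).1 ha).ofReal (𝕜 := ℂ)).congr
    (Eventually.of_forall fun x => (condExp_star_mul_self' a x).symm)

theorem integral_norm_vec_sq (hψ : ∀ a : ReducedCStar φ, 0 ≤ a → ψ a = measureWeight m a)
    (a : ReducedCStar φ) : ∫ x, ‖vec a x‖ ^ 2 ∂m = (ψ (star a * a)).toReal := by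
  rw [weight_star_mul_self hψ]
  exact integral_eq_lintegral_of_nonneg_ae (Eventually.of_forall fun x => sq_nonneg _)
    (continuous_norm_vec_sq a).aestronglyMeasurable

theorem add_mem_leftIdeal (hψ : ∀ a : ReducedCStar φ, 0 ≤ a → ψ a = measureWeight m a)
    {a b : ReducedCStar φ} (ha : a ∈ KMS.leftIdeal ψ) (hb : b ∈ KMS.leftIdeal ψ) :
    a + b ∈ KMS.leftIdeal ψ := by
  rw [mem_leftIdeal_iff hψ] at *
  refine ((ha.const_mul 2).add (hb.const_mul 2)).mono'
    (continuous_norm_vec_sq _).aestronglyMeasurable (Eventually.of_forall fun x => ?_)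
  rw [vec_add, Real.norm_of_nonneg (sq_nonneg _)]
  have h := norm_add_le (vec a x) (vec b x)
  change ‖vec a x + vec b x‖ ^ 2 ≤ 2 * ‖vec a x‖ ^ 2 + 2 * ‖vec b x‖ ^ 2
  nlinarith [norm_nonneg (vec a x + vec b x), sq_nonneg (‖vec a x‖ - ‖vec b x‖)]

theorem smul_mem_leftIdeal (hψ : ∀ a : ReducedCStar φ, 0 ≤ a → ψ a = measureWeight m a)
    (c : ℂ) {a : ReducedCStar φ} (ha : a ∈ KMS.leftIdeal ψ) : c • a ∈ KMS.leftIdeal ψ := by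
  rw [mem_leftIdeal_iff hψ] at *
  refine (ha.const_mul (‖c‖ ^ 2)).congr (Eventually.of_forall fun x => ?_)
  simp only [vec_smul, norm_smul, mul_pow]

theorem sub_mem_leftIdeal (hψ : ∀ a : ReducedCStar φ, 0 ≤ a → ψ a = measureWeight m a)
    {a b : ReducedCStar φ} (ha : a ∈ KMS.leftIdeal ψ) (hb : b ∈ KMS.leftIdeal ψ) :
    a - b ∈ KMS.leftIdeal ψ := by
  have := add_mem_leftIdeal hψ ha (smul_mem_leftIdeal hψ (-1) hb)
  rwa [neg_one_smul, ← sub_eq_add_neg] at this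

/-- The linear extension of a diagonal weight is given by integration of the conditional
expectation. -/
theorem linearExtension_eq_integral
    (hψ : ∀ a : ReducedCStar φ, 0 ≤ a → ψ a = measureWeight m a)
    {L : KMS.definitionSpace ψ →ₗ[ℂ] ℂ} (hL : KMS.IsLinearExtension ψ L)
    (c : KMS.definitionSpace ψ) :
    Integrable (condExp (c : ReducedCStar φ)) m ∧ L c = ∫ x, condExp (c : ReducedCStar φ) x ∂m := by
  let P : KMS.definitionSpace ψ → Prop := fun c =>
    Integrable (condExp (c : ReducedCStar φ)) m ∧ L c = ∫ x, condExp (c : ReducedCStar φ) x ∂m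
  have hadd : ∀ c d, P c → P d → P (c + d) := fun c d hc hd =>
    ⟨hc.1.add hd.1, by
      rw [map_add, hc.2, hd.2, ← integral_add hc.1 hd.1]
      rfl⟩
  have hsmul : ∀ (z : ℂ) c, P c → P (z • c) := fun z c hc =>
    ⟨hc.1.const_mul z, by
      rw [map_smul, hc.2, smul_eq_mul, ← integral_const_mul]
      rfl⟩
  have hpos : ∀ (a : ReducedCStar φ) (ha : a ∈ KMS.leftIdeal ψ),
      P ⟨_, star_mul_self_mem_definitionSpace ha⟩ := fun a ha => by
    refine ⟨integrable_condExp_star_mul_self hψ ha,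
      (hL ⟨_, star_mul_self_mem_definitionSpace ha⟩ (star_mul_self_nonneg a)).2.trans ?_⟩
    change ((ψ (star a * a)).toReal : ℂ) = ∫ x, condExp (star a * a) x ∂m
    rw [integral_condExp_star_mul_self, integral_norm_vec_sq hψ]
  suffices ∀ (c : ReducedCStar φ) (hc : c ∈ KMS.definitionSpace ψ), P ⟨c, hc⟩ from this c.1 c.2
  intro c hc
  induction hc using Submodule.span_induction with
  | mem c hc =>
    obtain ⟨a, ha, b, hb, rfl⟩ := hc
    -- Polarization reduces a generator of the definition space to elements `star x * x`, where the
    -- weight itself is known.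
    have hIb := smul_mem_leftIdeal hψ Complex.I hb
    have h := hsmul (1 / 4) _ (hadd _ _ (hadd _ _ (hadd _ _ (hpos _ (add_mem_leftIdeal hψ ha hb))
      (hsmul (-1) _ (hpos _ (sub_mem_leftIdeal hψ ha hb))))
      (hsmul (-Complex.I) _ (hpos _ (add_mem_leftIdeal hψ ha hIb))))
      (hsmul Complex.I _ (hpos _ (sub_mem_leftIdeal hψ ha hIb))))
    convert h using 1
    refine Subtype.ext ?_
    have h4 := star_mul_polarization a b
    calc star a * b = (1 / 4 : ℂ) • (4 : ℂ) • (star a * b) := by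
          rw [smul_smul]
          norm_num
      _ = _ := by
          rw [h4]
          simp only [Submodule.coe_smul, Submodule.coe_add]
          module
  | zero =>
    have := hsmul 0 0 ⟨integrable_zero _ _ _, by
      rw [map_zero]
      exact integral_zero _ _ |>.symm⟩
    rw [zero_smul] at this
    exact this
  | add c d hc hd ihc ihd => exact hadd ⟨c, hc⟩ ⟨d, hd⟩ ihc ihd
  | smul z c hc ih => exact hsmul z ⟨c, hc⟩ ih

/-- The KMS condition for a diagonal weight in terms of integrals. -/
theorem exists_kms_function (hψ : ∀ a : ReducedCStar φ, 0 ≤ a → ψ a = measureWeight m a)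
    {α : KMS.OneParameterGroup (ReducedCStar φ)} {β : ℝ} (hK : KMS.IsKMSWeight α β ψ)
    {a b : ReducedCStar φ} (ha : a ∈ KMS.leftIdeal ψ) (ha' : star a ∈ KMS.leftIdeal ψ)
    (hb : b ∈ KMS.leftIdeal ψ) (hb' : star b ∈ KMS.leftIdeal ψ) :
    ∃ F : ℂ → ℂ, ContinuousOn F (KMS.strip β) ∧ (∃ C : ℝ, ∀ z ∈ KMS.strip β, ‖F z‖ ≤ C) ∧
      DifferentiableOn ℂ F (interior (KMS.strip β)) ∧ ∀ t : ℝ,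
        (Integrable (condExp (a * α.toFun t b)) m ∧ F t = ∫ x, condExp (a * α.toFun t b) x ∂m) ∧
        (Integrable (condExp (α.toFun t b * a)) m ∧
          F (t + β * Complex.I) = ∫ x, condExp (α.toFun t b * a) x ∂m) := by
  obtain ⟨L, hL, H⟩ := hK.kms
  obtain ⟨F, h1, h2, h3, h4⟩ := H a b ha ha' hb hb'
  refine ⟨F, h1, h2, h3, fun t => ?_⟩
  obtain ⟨⟨hm1, e1⟩, hm2, e2⟩ := h4 t
  have i1 := linearExtension_eq_integral hψ hL ⟨_, hm1⟩
  have i2 := linearExtension_eq_integral hψ hL ⟨_, hm2⟩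
  exact ⟨⟨i1.1, e1.trans i1.2⟩, i2.1, e2.trans i2.2⟩

/-! ### Full support of the measure and invariance of the diagonal -/

theorem integrable_condExp_ofCc [IsFiniteMeasureOnCompacts m] (f : C_c(φ.Gpd, ℂ)) :
    Integrable (condExp (ofCc f)) m := by
  refine (continuous_condExp _).integrable_of_hasCompactSupport ?_
  refine HasCompactSupport.intro (f.hasCompactSupport.isCompact.image continuous_src)
    fun x hx => ?_
  rw [condExp_ofCc]
  by_contra h
  exact hx ⟨_, subset_tsupport _ h, rfl⟩

theorem ofCc_mem_leftIdeal [IsFiniteMeasureOnCompacts m]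
    (hψ : ∀ a : ReducedCStar φ, 0 ≤ a → ψ a = measureWeight m a) (f : C_c(φ.Gpd, ℂ)) :
    ofCc f ∈ KMS.leftIdeal ψ := by
  rw [mem_leftIdeal_iff hψ]
  have h := (integrable_condExp_ofCc (m := m) (conv (invol f) f)).re
  rw [ofCc_conv, ofCc_invol] at h
  refine h.congr (Eventually.of_forall fun x => ?_)
  simp only [condExp_star_mul_self']
  exact Complex.ofReal_re _

theorem star_ofCc_mem_leftIdeal [IsFiniteMeasureOnCompacts m]
    (hψ : ∀ a : ReducedCStar φ, 0 ≤ a → ψ a = measureWeight m a) (f : C_c(φ.Gpd, ℂ)) :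
    star (ofCc f) ∈ KMS.leftIdeal ψ := by
  rw [← ofCc_invol]
  exact ofCc_mem_leftIdeal hψ _

/-- Null open sets propagate from source to range. For `f` supported over `O` the KMS function of
`star f` and `f` vanishes on the real line, hence at `β * I`, where its value is `ψ (f * star f)`.
-/
theorem exists_null_nhds_rng [LocallyCompactSpace X] [IsFiniteMeasureOnCompacts m]
    (hψ : ∀ a : ReducedCStar φ, 0 ≤ a → ψ a = measureWeight m a)
    {α : KMS.OneParameterGroup (ReducedCStar φ)} {β : ℝ} (hβ : β ≠ 0)
    (hK : KMS.IsKMSWeight α β ψ) (g : φ.Gpd) {O : Set X} (hO : IsOpen O) (hg : g.src ∈ O)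
    (hm : m O = 0) : ∃ V : Set X, IsOpen V ∧ g.rng ∈ V ∧ m V = 0 := by
  obtain ⟨f, hfg, hfO⟩ := exists_bump g (hO.preimage continuous_src) hg
  have hvec : ∀ x ∉ O, vec (ofCc f) x = 0 := fun x hx => by
    refine lp.ext (funext fun h => ?_)
    change rep (ofCc f) x (delta (Fiber.unit φ x)) h = 0
    rw [rep_delta, coeff_ofCc]
    by_contra hne
    exact hx (hfO _ hne)
  have hae : ∀ᵐ x ∂m, vec (ofCc f) x = 0 := by
    have : ∀ᵐ x ∂m, x ∉ O := by
      rw [ae_iff]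
      simpa using hm
    filter_upwards [this] with x hx using hvec x hx
  obtain ⟨F, h1, h2, h3, h4⟩ := exists_kms_function hψ hK (star_ofCc_mem_leftIdeal hψ f)
    (by rw [star_star]; exact ofCc_mem_leftIdeal hψ f) (ofCc_mem_leftIdeal hψ f)
    (star_ofCc_mem_leftIdeal hψ f)
  have h0 := StripAnalysis.eq_zero_of_eq_zero hβ h1 h2 h3 fun t => by
    rw [(h4 t).1.2]
    refine integral_eq_zero_of_ae ?_
    filter_upwards [hae] with x hx
    rw [condExp_star_mul', hx, inner_zero_left]
    rfl
  have h5 := (h4 0).2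
  rw [α.zero_apply, Complex.ofReal_zero, zero_add, h0] at h5
  have h6 := integral_condExp_star_mul_self (m := m) (star (ofCc f))
  rw [star_star, ← h5.2] at h6
  have h7 : ∫ x, ‖vec (star (ofCc f)) x‖ ^ 2 ∂m = 0 := by
    exact_mod_cast h6.symm
  rw [integral_eq_zero_iff_of_nonneg (fun x => sq_nonneg _)
    ((mem_leftIdeal_iff hψ _).1 (star_ofCc_mem_leftIdeal hψ f))] at h7
  -- This open set is null because a non-negative integral vanishes, and it contains `g.rng` because
  -- `star f` has coefficient `1` at the inverse of `g`.
  refine ⟨{x | ‖vec (star (ofCc f)) x‖ ^ 2 ≠ 0},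
    isOpen_ne_fun (continuous_norm_vec_sq _) continuous_const, ?_, h7⟩
  intro h8
  have h9 : vec (star (ofCc f)) (Gpd.inv g).src = 0 :=
    norm_eq_zero.1 (pow_eq_zero_iff two_ne_zero |>.1 h8)
  have h10 := vec_apply (star (ofCc f)) (Gpd.inv g)
  rw [h9, ← ofCc_invol, coeff_ofCc, invol_apply, Gpd.inv_inv, hfg, star_one] at h10
  exact zero_ne_one h10

/-- By minimality every orbit meets a given non-empty open set. If that set were null, every point
would have a null neighbourhood, and second countability would make `m`, hence `ψ`, zero. -/
theorem isOpenPosMeasure [SecondCountableTopology X] [LocallyCompactSpace X] [IsFiniteMeasureOnCompacts m]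
    (hmin : φ.IsMinimal) (hψ : ∀ a : ReducedCStar φ, 0 ≤ a → ψ a = measureWeight m a)
    {α : KMS.OneParameterGroup (ReducedCStar φ)} {β : ℝ} (hβ : β ≠ 0)
    (hK : KMS.IsKMSWeight α β ψ) : m.IsOpenPosMeasure := by
  refine ⟨fun V hV hVne hV0 => ?_⟩
  have hloc : ∀ y : X, ∃ O, IsOpen O ∧ y ∈ O ∧ m O = 0 := fun y => by
    obtain ⟨x, hxV, n, k, hn, hk, e⟩ := (hmin y).inter_open_nonempty V hV hVne
    exact exists_null_nhds_rng hψ hβ hK ⟨y, (n : ℤ) - k, x, n, k, rfl, hn, hk, e.symm⟩ hV hxV hV0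
  have h0 : m univ = 0 := measure_null_of_locally_null _ fun y _ => by
    obtain ⟨O, hO, hy, hm⟩ := hloc y
    exact ⟨O, mem_nhdsWithin_of_mem_nhds (hO.mem_nhds hy), hm⟩
  obtain ⟨a, ha, hne⟩ := hK.ne_zero
  refine hne ?_
  rw [hψ a ha, measureWeight, Measure.measure_univ_eq_zero.1 h0, lintegral_zero_measure]

/-- Diagonal elements commute with everything under the conditional expectation, so the KMS function
of `d` with itself is periodic and therefore constant. All four terms in the expansion of `ψ
((α_s(d) - d)²)` then equal `F 0` and cancel. -/
theorem apply_diag_eq [SecondCountableTopology X] [LocallyCompactSpace X] [IsFiniteMeasureOnCompacts m]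
    (hmin : φ.IsMinimal) (hψ : ∀ a : ReducedCStar φ, 0 ≤ a → ψ a = measureWeight m a)
    {α : KMS.OneParameterGroup (ReducedCStar φ)} {β : ℝ} (hβ : β ≠ 0)
    (hK : KMS.IsKMSWeight α β ψ) {f : C_c(X, ℂ)} (hf : ∀ x, star (f x) = f x) (s : ℝ) :
    α.toFun s (ofCc (diag f)) = ofCc (diag f) := by
  have := isOpenPosMeasure hmin hψ hβ hK
  set d : ReducedCStar φ := ofCc (diag f) with hd
  have hsd : star d = d := by rw [hd, ← ofCc_invol, diag_eq_invol hf]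
  have hdm : d ∈ KMS.leftIdeal ψ := ofCc_mem_leftIdeal hψ _
  have hdm' : star d ∈ KMS.leftIdeal ψ := by rwa [hsd]
  obtain ⟨F, h1, h2, h3, h4⟩ := exists_kms_function hψ hK hdm hdm' hdm hdm'
  have hcomm : ∀ (b : ReducedCStar φ) x, condExp (d * b) x = condExp (b * d) x := fun b x => by
    rw [condExp_eq_coeff, condExp_eq_coeff, coeff_diag_mul, coeff_mul_diag, mul_comm]
    rfl
  have hF : ∀ t : ℝ, F t = F 0 := fun t =>
    StripAnalysis.eq_of_periodic hβ h1 h2 h3 (fun t => by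
      rw [(h4 t).1.2, (h4 t).2.2]
      exact integral_congr_ae (Eventually.of_forall fun x => (hcomm _ x).symm)) t
  have hsα : star (α.toFun s d) = α.toFun s d := by rw [← map_star, hsd]
  -- the four terms of the square of the difference
  have e1 := (h4 0).1
  rw [α.zero_apply, Complex.ofReal_zero] at e1
  have e2 := (h4 s).1
  rw [hF] at e2
  have e3 : Integrable (condExp (α.toFun s d * d)) m ∧
      F 0 = ∫ x, condExp (α.toFun s d * d) x ∂m := by
    refine ⟨(h4 s).2.1, e2.2.trans ?_⟩
    exact integral_congr_ae (Eventually.of_forall fun x => hcomm _ x)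
  have hinv : ψ (star (α.toFun s d) * α.toFun s d) = ψ (star d * d) := by
    rw [← map_star, ← map_mul, hK.invariant s _ (star_mul_self_nonneg d)]
  have hαm : α.toFun s d ∈ KMS.leftIdeal ψ := by
    rw [KMS.leftIdeal, mem_ofPred_eq, hinv]
    exact hdm
  have e4 : Integrable (condExp (α.toFun s d * α.toFun s d)) m ∧
      F 0 = ∫ x, condExp (α.toFun s d * α.toFun s d) x ∂m := by
    have h5 := integrable_condExp_star_mul_self hψ hαm
    have h6 := integral_condExp_star_mul_self (m := m) (α.toFun s d)
    rw [integral_norm_vec_sq hψ, hinv, ← integral_norm_vec_sq hψ,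
      ← integral_condExp_star_mul_self, hsd, hsα] at h6
    rw [hsα] at h5
    exact ⟨h5, e1.2.trans h6.symm⟩
  have hc := sub_mem_leftIdeal hψ hαm hdm
  have hexp : ∀ x, condExp (star (α.toFun s d - d) * (α.toFun s d - d)) x =
      (condExp (α.toFun s d * α.toFun s d) x - condExp (α.toFun s d * d) x) -
        (condExp (d * α.toFun s d) x - condExp (d * d) x) := fun x => by
    rw [star_sub, hsd, hsα, ← condExp_sub, ← condExp_sub, ← condExp_sub]
    congr 1
    noncomm_ring
  have hzero : ∫ x, condExp (star (α.toFun s d - d) * (α.toFun s d - d)) x ∂m = 0 := by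
    calc _ = ∫ x, ((condExp (α.toFun s d * α.toFun s d) x - condExp (α.toFun s d * d) x) -
        (condExp (d * α.toFun s d) x - condExp (d * d) x)) ∂m :=
          integral_congr_ae (Eventually.of_forall hexp)
      _ = 0 := by
        refine (integral_sub (e4.1.sub e3.1) (e2.1.sub e1.1)).trans ?_
        simp only [Pi.sub_apply]
        rw [integral_sub e4.1 e3.1, integral_sub e2.1 e1.1, ← e1.2, ← e2.2, ← e3.2, ← e4.2]
        ring
  rw [← sub_eq_zero]
  refine eq_zero_of_condExp_star_mul_self fun x => ?_
  rw [integral_condExp_star_mul_self] at hzero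
  rw [condExp_star_mul_self']
  have h7 : ∫ x, ‖vec (α.toFun s d - d) x‖ ^ 2 ∂m = 0 := by
    exact_mod_cast hzero
  -- Full support upgrades vanishing almost everywhere to vanishing at every point, since the
  -- integrand is continuous.
  rw [integral_eq_zero_iff_of_nonneg (fun x => sq_nonneg _) ((mem_leftIdeal_iff hψ _).1 hc),
    Continuous.ae_eq_iff_eq m (continuous_norm_vec_sq _) continuous_zero] at h7
  rw [congrFun h7 x]
  simp

end Weight

end PartialLocalHomeo

/-! ## Automorphisms fixing the diagonal -/

namespace PartialLocalHomeo

variable {X : Type*} [TopologicalSpace X] {φ : PartialLocalHomeo X}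

open Gpd

/-- A unit with trivial isotropy. -/
def HasTrivialIsotropy (φ : PartialLocalHomeo X) (x : X) : Prop :=
  ∀ g : φ.Gpd, g.rng = x → g.src = x → g.deg = 0

theorem IsAperiodic.hasTrivialIsotropy {x : X} (hx : φ.IsAperiodic x) :
    φ.HasTrivialIsotropy x := by
  intro g hr hs
  obtain ⟨n, m, hd, h⟩ := g.exists_rel
  rw [hr, hs] at h
  rw [hd, hx n m h.1 h.2.1 h.2.2, sub_self]

theorem HasTrivialIsotropy.rng {k : φ.Gpd} (h : φ.HasTrivialIsotropy k.src) :
    φ.HasTrivialIsotropy k.rng := by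
  intro g hr hs
  have := h (Gpd.mul (Gpd.inv k) (Gpd.mul g k hs) hr.symm) rfl rfl
  simpa [Gpd.mul, Gpd.inv] using this

/-- Conjugation carries trivial isotropy along orbits, and minimality makes the orbit of the
aperiodic point dense. -/
theorem dense_hasTrivialIsotropy (hmin : φ.IsMinimal) (hap : ∃ x : X, φ.IsAperiodic x) :
    Dense {x | φ.HasTrivialIsotropy x} := by
  obtain ⟨x, hx⟩ := hap
  refine (hmin x).mono ?_
  rintro y ⟨n, m, hn, hm, e⟩
  exact HasTrivialIsotropy.rng (k := ⟨y, (m : ℤ) - n, x, m, n, rfl, hm, hn, e⟩)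
    hx.hasTrivialIsotropy

theorem exists_real_bump [T2Space X] [LocallyCompactSpace X] (x : X) {O : Set X} (hO : IsOpen O)
    (hx : x ∈ O) : ∃ f : C_c(X, ℂ), f x = 1 ∧ (∀ y, f y ≠ 0 → y ∈ O) ∧ (∀ y, ‖f y‖ ≤ 1) ∧
      ∀ y, star (f y) = f y := by
  obtain ⟨f, hf1, hf0, hfc, hfI⟩ := exists_continuous_one_zero_of_isCompact
    (isCompact_singleton (x := x)) hO.isClosed_compl (disjoint_compl_right_iff_subset.2
      (singleton_subset_iff.2 hx))
  refine ⟨⟨⟨fun y => (f y : ℂ), by fun_prop⟩, hfc.comp_left (g := fun r : ℝ => (r : ℂ)) (by simp)⟩,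
    ?_, fun y hy => ?_, fun y => ?_, fun y => Complex.conj_ofReal _⟩
  · simpa using hf1 (mem_singleton x)
  · by_contra hyO
    exact hy (by simpa using hf0 hyO)
  · change ‖(f y : ℂ)‖ ≤ 1
    rw [Complex.norm_of_nonneg (hfI y).1]
    exact (hfI y).2

/-- A `*`-automorphism fixing the diagonal does not increase the modulus of the coefficients at
groupoid elements whose source has trivial isotropy. -/
theorem norm_coeff_apply_le_of_hasTrivialIsotropy [T2Space X] [LocallyCompactSpace X]
    {θ : ReducedCStar φ ≃⋆ₐ[ℂ] ReducedCStar φ}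
    (hθ : ∀ f : C_c(X, ℂ), (∀ x, star (f x) = f x) → θ (ofCc (diag f)) = ofCc (diag f))
    {g : φ.Gpd} (hg : φ.HasTrivialIsotropy g.src) (a : ReducedCStar φ) :
    ‖coeff (θ a) g‖ ≤ ‖coeff a g‖ := by
  refine ofCc_induction (p := fun a => ‖coeff (θ a) g‖ ≤ ‖coeff a g‖)
    (isClosed_le ((continuous_coeff_left g).comp (StarAlgEquiv.isometry θ).continuous).norm
      (continuous_coeff_left g).norm) (fun k => ?_) a
  rw [coeff_ofCc]
  refine le_of_forall_pos_le_add fun ε hε => ?_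
  obtain ⟨B, hBo, hgB, hBr, hBs⟩ := exists_bisection g
  set O : Set φ.Gpd := B ∩ {ξ | ‖k ξ‖ < ‖k g‖ + ε} with hOdef
  have hO : IsOpen O := hBo.inter (isOpen_lt k.continuous.norm continuous_const)
  have hgO : g ∈ O := ⟨hgB, by simpa using hε⟩
  have hK : IsCompact ((fun ξ : φ.Gpd => (ξ.rng, ξ.src)) '' (tsupport k \ O)) :=
    (k.hasCompactSupport.isCompact.diff hO).image (continuous_rng.prodMk continuous_src)
  -- An element `ξ` with the range and source of `g` gives an isotropy element `g⁻¹ξ` at `g.src`, so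
  -- `ξ = g`, which lies in `O`. Hence cutting `k` by range and source near those of `g` confines
  -- its support to `O`.
  have hnot : (g.rng, g.src) ∉ (fun ξ : φ.Gpd => (ξ.rng, ξ.src)) '' (tsupport k \ O) := by
    rintro ⟨ξ, ⟨-, hξO⟩, hξ⟩
    rw [Prod.mk.injEq] at hξ
    have h0 := hg (Gpd.mul (Gpd.inv g) ξ hξ.1.symm) rfl hξ.2
    have h1 : ξ = g := Gpd.ext hξ.1 (by simp only [Gpd.mul, Gpd.inv] at h0; omega) hξ.2
    exact hξO (h1 ▸ hgO)
  obtain ⟨W, V, hW, hV, hgW, hgV, hWV⟩ := isOpen_prod_iff.1 hK.isClosed.isOpen_compl _ _ hnot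
  obtain ⟨f, hf1, hfW, hfn, hfr⟩ := exists_real_bump g.rng hW hgW
  obtain ⟨f', hf1', hfV, hfn', hfr'⟩ := exists_real_bump g.src hV hgV
  set p : C_c(φ.Gpd, ℂ) := conv (conv (diag f) k) (diag f') with hp
  have hpd : ofCc p = ofCc (diag f) * ofCc k * ofCc (diag f') := by rw [hp, ofCc_conv, ofCc_conv]
  have hpv : ∀ ξ, p ξ = f ξ.rng * k ξ * f' ξ.src := fun ξ => by
    rw [← coeff_ofCc, hpd, coeff_mul_diag, coeff_diag_mul, coeff_ofCc]
  have hsupp : ∀ ξ, p ξ ≠ 0 → ξ ∈ O := fun ξ hξ => by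
    rw [hpv] at hξ
    have h1 := right_ne_zero_of_mul hξ
    have h2 := left_ne_zero_of_mul (left_ne_zero_of_mul hξ)
    have h3 := right_ne_zero_of_mul (left_ne_zero_of_mul hξ)
    by_contra hξO
    exact hWV (mk_mem_prod (hfW _ h2) (hfV _ h1)) ⟨ξ, ⟨subset_tsupport _ h3, hξO⟩, rfl⟩
  have hnorm : ‖ofCc p‖ ≤ ‖k g‖ + ε := by
    refine norm_ofCc_le (by positivity) (fun ξ => ?_) (hBr.mono fun ξ hξ => (hsupp ξ hξ).1)
      (hBs.mono fun ξ hξ => (hsupp ξ hξ).1)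
    by_cases hξ : p ξ = 0
    · rw [hξ, norm_zero]
      positivity
    · have h1 : ‖k ξ‖ < ‖k g‖ + ε := (hsupp ξ hξ).2
      rw [hpv, norm_mul, norm_mul]
      have h2 : ‖f ξ.rng‖ * ‖k ξ‖ ≤ ‖k ξ‖ :=
        mul_le_of_le_one_left (norm_nonneg _) (hfn _)
      exact (mul_le_of_le_one_right (by positivity) (hfn' _)).trans (h2.trans h1.le)
  -- Since `θ` fixes both cut-off functions, which are `1` at `g.rng` and `g.src`, the cut leaves
  -- the coefficient of the image at `g` unchanged.
  calc ‖coeff (θ (ofCc k)) g‖ = ‖coeff (θ (ofCc p)) g‖ := by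
        rw [hpd, map_mul, map_mul, hθ f hfr, hθ f' hfr', coeff_mul_diag, coeff_diag_mul, hf1, hf1',
          one_mul, mul_one]
    _ ≤ ‖θ (ofCc p)‖ := norm_coeff_le _ _
    _ ≤ ‖k g‖ + ε := by rwa [StarAlgEquiv.norm_map]

/-- The source map is open, so the elements whose source has trivial isotropy are dense, and both
sides are continuous on the groupoid. -/
theorem norm_coeff_apply_le [T2Space X] [LocallyCompactSpace X]
    (hdense : Dense {x | φ.HasTrivialIsotropy x})
    {θ : ReducedCStar φ ≃⋆ₐ[ℂ] ReducedCStar φ}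
    (hθ : ∀ f : C_c(X, ℂ), (∀ x, star (f x) = f x) → θ (ofCc (diag f)) = ofCc (diag f))
    (g : φ.Gpd) (a : ReducedCStar φ) : ‖coeff (θ a) g‖ ≤ ‖coeff a g‖ := by
  have hd : Dense (Gpd.src ⁻¹' {x | φ.HasTrivialIsotropy x} : Set φ.Gpd) :=
    hdense.preimage isOpenMap_src
  have hcl : IsClosed {g : φ.Gpd | ‖coeff (θ a) g‖ ≤ ‖coeff a g‖} :=
    isClosed_le (continuous_coeff _).norm (continuous_coeff _).norm
  have := hcl.closure_subset_iff.2 fun g hg =>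
    norm_coeff_apply_le_of_hasTrivialIsotropy hθ hg a
  exact this (hd g)

/-- By the inequality of moduli, the functional `a ↦ coeff (θ a) g` vanishes on the kernel of `a ↦
coeff a g`, so it is a scalar multiple of it. -/
theorem exists_multiplier [T2Space X] [LocallyCompactSpace X]
    (hdense : Dense {x | φ.HasTrivialIsotropy x})
    {θ : ReducedCStar φ ≃⋆ₐ[ℂ] ReducedCStar φ}
    (hθ : ∀ f : C_c(X, ℂ), (∀ x, star (f x) = f x) → θ (ofCc (diag f)) = ofCc (diag f))
    (g : φ.Gpd) : ∃ u : ℂ, ∀ a : ReducedCStar φ, coeff (θ a) g = u * coeff a g := by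
  obtain ⟨f, hf, -⟩ := exists_bump g isOpen_univ (mem_univ g)
  refine ⟨coeff (θ (ofCc f)) g, fun a => ?_⟩
  have h := norm_coeff_apply_le hdense hθ g (a - coeff a g • ofCc f)
  rw [coeff_sub, coeff_smul, coeff_ofCc, hf, mul_one, sub_self, norm_zero, map_sub, map_smul,
    coeff_sub, coeff_smul] at h
  rw [mul_comm]
  exact sub_eq_zero.1 (norm_le_zero_iff.1 h)

theorem continuous_coeff_uncurry [T2Space X] :
    Continuous fun p : ReducedCStar φ × φ.Gpd => coeff p.1 p.2 := by
  refine continuous_prod_of_continuous_lipschitzWith _ 1 continuous_coeff fun g =>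
    LipschitzWith.of_dist_le_mul fun a b => ?_
  rw [NNReal.coe_one, one_mul, dist_eq_norm, dist_eq_norm]
  exact norm_coeff_le (a - b) g

/-- If `b` is supported in a set on which the source map is injective, then `a * b` is given by
a single product at `g h`, for `h` in this set. -/
theorem coeff_mul_of_injOn [T2Space X] (a b : ReducedCStar φ) {B : Set φ.Gpd}
    (hB : InjOn Gpd.src B) (hb : ∀ ξ, coeff b ξ ≠ 0 → ξ ∈ B) {g h : φ.Gpd} (hh : h ∈ B)
    (hgh : g.src = h.rng) : coeff (a * b) (Gpd.mul g h hgh) = coeff a g * coeff b h := by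
  have hvec : rep b h.src (delta (Fiber.unit φ h.src)) = coeff b h • delta (Fiber.self h) := by
    refine lp.ext (funext fun l => ?_)
    change _ = coeff b h * delta (Fiber.self h) l
    have hl : l.div (Fiber.unit φ h.src) = l.1 :=
      Gpd.ext rfl (by simp [Fiber.div, Gpd.mul, Gpd.inv, Gpd.unit, Fiber.unit]) l.2.symm
    rw [rep_delta, hl]
    by_cases hlh : l = Fiber.self h
    · rw [hlh, delta_self, mul_one]
      rfl
    · rw [delta_ne hlh, mul_zero]
      by_contra hne
      exact hlh (Subtype.ext (hB (hb _ hne) hh l.2))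
  let l : Fiber φ h.src := ⟨Gpd.mul g h hgh, rfl⟩
  have h1 : coeff (a * b) (Gpd.mul g h hgh) =
      rep a h.src (rep b h.src (delta (Fiber.unit φ h.src))) l := rfl
  rw [h1, hvec, map_smul]
  change coeff b h * rep a h.src (delta (Fiber.self h)) l = _
  rw [rep_delta, mul_comm]
  congr 2
  exact Gpd.ext rfl (by simp [Fiber.div, Gpd.mul, Gpd.inv, Fiber.self, l]) hgh.symm

theorem eq_of_forall_exp_eq {a b : ℝ}
    (h : ∀ t : ℝ, Complex.exp (Complex.I * t * a) = Complex.exp (Complex.I * t * b)) : a = b := by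
  by_contra hab
  have hne : ((a : ℂ) - b) ≠ 0 := by
    rw [← Complex.ofReal_sub, Complex.ofReal_ne_zero]
    exact sub_ne_zero.2 hab
  -- At `t = π / (a - b)` the two exponentials differ by the factor `-1`.
  have h1 : Complex.exp (Complex.I * (Real.pi / (a - b) : ℝ) * a -
      Complex.I * (Real.pi / (a - b) : ℝ) * b) = 1 := by
    rw [Complex.exp_sub, h, div_self (Complex.exp_ne_zero _)]
  have h2 : Complex.I * (Real.pi / (a - b) : ℝ) * a - Complex.I * (Real.pi / (a - b) : ℝ) * b =
      Real.pi * Complex.I := by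
    push_cast
    field_simp
  rw [h2, Complex.exp_pi_mul_I] at h1
  norm_num at h1

/-- A continuous one-parameter group fixing the diagonal acts by multiplication with the phases
given by a continuous real-valued homomorphism on the groupoid. -/
theorem exists_continuous_homomorphism [T2Space X] [LocallyCompactSpace X]
    (hdense : Dense {x | φ.HasTrivialIsotropy x}) (α : KMS.OneParameterGroup (ReducedCStar φ))
    (hα : ∀ (t : ℝ) (f : C_c(X, ℂ)), (∀ x, star (f x) = f x) →
      α.toFun t (ofCc (diag f)) = ofCc (diag f)) :
    ∃ c : φ.Gpd → ℝ, Continuous c ∧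
      (∀ (t : ℝ) (a : ReducedCStar φ) (g : φ.Gpd),
        coeff (α.toFun t a) g = Complex.exp (Complex.I * t * c g) * coeff a g) ∧
      (∀ x, c (Gpd.unit φ x) = 0) ∧
      ∀ (g h : φ.Gpd) (hgh : g.src = h.rng), c (Gpd.mul g h hgh) = c g + c h := by
  choose u hu using fun t => exists_multiplier hdense (hα t)
  have hbump : ∀ g : φ.Gpd, ∃ f : C_c(φ.Gpd, ℂ), f g = 1 := fun g =>
    let ⟨f, hf, _⟩ := exists_bump g isOpen_univ (mem_univ g)
    ⟨f, hf⟩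
  have hval : ∀ t (g : φ.Gpd) (f : C_c(φ.Gpd, ℂ)), f g = 1 →
      u t g = coeff (α.toFun t (ofCc f)) g := fun t g f hf => by
    rw [hu, coeff_ofCc, hf, mul_one]
  -- Near a given point the multiplier is a quotient of jointly continuous coefficients of one fixed
  -- `f`.
  have hcont : Continuous fun p : ℝ × φ.Gpd => u p.1 p.2 := by
    refine continuous_iff_continuousAt.2 fun p => ?_
    obtain ⟨f, hf⟩ := hbump p.2
    have h1 : Continuous fun q : ℝ × φ.Gpd => coeff (α.toFun q.1 (ofCc f)) q.2 :=
      continuous_coeff_uncurry.comp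
        (((α.continuous (ofCc f)).comp continuous_fst).prodMk continuous_snd)
    have h2 : Continuous fun q : ℝ × φ.Gpd => f q.2 := f.continuous.comp continuous_snd
    have h3 : f p.2 ≠ 0 := by
      rw [hf]
      exact one_ne_zero
    refine (h1.continuousAt.div h2.continuousAt h3).congr ?_
    filter_upwards [h2.continuousAt.eventually_ne h3] with q hq
    rw [Pi.div_apply, hu, coeff_ofCc, mul_div_cancel_right₀ _ hq]
  obtain ⟨c, hc, hcu⟩ := StripAnalysis.exists_exponent hcont
    (fun g => by
      obtain ⟨f, hf⟩ := hbump g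
      rw [hval 0 g f hf, α.zero_apply, coeff_ofCc, hf])
    (fun s t g => by
      obtain ⟨f, hf⟩ := hbump g
      rw [hval (s + t) g f hf, α.map_add, hu, hval t g f hf])
    (fun t g => by
      obtain ⟨f, hf⟩ := hbump g
      rw [hval t g f hf]
      refine (norm_coeff_apply_le hdense (hα t) g _).trans ?_
      rw [coeff_ofCc, hf, norm_one])
  refine ⟨c, hc, fun t a g => by rw [hu, hcu], fun x => ?_, fun g h hgh => ?_⟩
  · obtain ⟨f, hf1, -, -, hfr⟩ := exists_real_bump x isOpen_univ (mem_univ x)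
    refine eq_of_forall_exp_eq fun t => ?_
    rw [← hcu, hval t _ (diag f) (by rw [diag_unit, hf1]), hα t f hfr, coeff_ofCc, diag_unit, hf1]
    simp
  · obtain ⟨f, hf⟩ := hbump g
    obtain ⟨B, hBo, hhB, -, hBs⟩ := exists_bisection h
    obtain ⟨k, hk, hkB⟩ := exists_bump h hBo hhB
    refine eq_of_forall_exp_eq fun t => ?_
    -- The product formula is used before and after applying `α_t`, which only multiplies
    -- coefficients and so keeps the support in the bisection. Comparison gives the multiplicativity
    -- of the phase.
    have h1 := coeff_mul_of_injOn (ofCc f) (ofCc k) hBs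
      (fun ξ hξ => hkB ξ (by rwa [coeff_ofCc] at hξ)) hhB hgh
    have h2 := coeff_mul_of_injOn (α.toFun t (ofCc f)) (α.toFun t (ofCc k)) hBs
      (fun ξ hξ => hkB ξ (by
        rw [hu, coeff_ofCc] at hξ
        exact right_ne_zero_of_mul hξ)) hhB hgh
    rw [← map_mul, hu, h1, hu, hu, coeff_ofCc, coeff_ofCc, hf, hk] at h2
    simp only [mul_one] at h2
    rw [← hcu, h2, hcu, hcu, ← Complex.exp_add]
    congr 1
    push_cast
    ring

/-! ## Continuous homomorphisms are given by functions on the domain -/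

/-- The element `(x, n, φⁿ(x))` of the groupoid. -/
def iterElement {n : ℕ} {x : X} (hx : x ∈ φ.iterDom n) : φ.Gpd :=
  ⟨x, n, φ.toFun^[n] x, n, 0, by simp, hx, fun i hi => by omega, rfl⟩

theorem mem_iterDom_one {x : X} : x ∈ φ.iterDom 1 ↔ x ∈ φ.dom := by
  simp [iterDom]

/-- Take `F(x) = c(x, 1, φ(x))`. The element `(x, n, φⁿ(x))` is a product of `n` such elements, and
multiplying `(x, n - m, y)` by `(y, m, φᵐ(y))` gives `(x, n, φⁿ(x))`. -/
theorem exists_eq_cocycle {c : φ.Gpd → ℝ} (hc : Continuous c) (hunit : ∀ x, c (Gpd.unit φ x) = 0)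
    (hmul : ∀ (g h : φ.Gpd) (hgh : g.src = h.rng), c (Gpd.mul g h hgh) = c g + c h) :
    ∃ F : X → ℝ, ContinuousOn F φ.dom ∧ ∀ g, c g = cocycle F g := by
  classical
  -- Off the domain the unit is only a default; continuity of `F` is claimed on the domain alone.
  let e : X → φ.Gpd := fun x =>
    if hx : x ∈ φ.iterDom 1 then iterElement hx else Gpd.unit φ x
  have he : ∀ {x} (hx : x ∈ φ.iterDom 1), e x = iterElement hx := fun hx => dif_pos hx
  have hmem : ∀ {x} (hx : x ∈ φ.iterDom 1), e x ∈ relSet φ 1 0 := fun hx => by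
    rw [he hx]
    exact ⟨by simp [iterElement], hx, fun i hi => by omega, rfl⟩
  have hiter : ∀ (n : ℕ) {x : X} (hx : x ∈ φ.iterDom n),
      c (iterElement hx) = ∑ i ∈ Finset.range n, c (e (φ.toFun^[i] x)) := by
    intro n
    induction n with
    | zero =>
      intro x hx
      rw [Finset.sum_range_zero, ← hunit x]
      rfl
    | succ n ih =>
      intro x hx
      obtain ⟨h1, h2⟩ := mem_iterDom_add.1 hx
      have h3 : iterElement hx = Gpd.mul (iterElement h1) (iterElement h2)
          (show (iterElement h1).src = (iterElement h2).rng from rfl) :=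
        Gpd.ext rfl (by simp [iterElement, Gpd.mul]) (Function.iterate_succ_apply' _ _ _)
      rw [Finset.sum_range_succ, ← ih h1, he h2, h3, hmul]
  refine ⟨fun x => c (e x), fun x hx => ?_, fun g => ?_⟩
  · have hx1 := mem_iterDom_one.2 hx
    have hev : ∀ᶠ y in 𝓝 x, y ∈ φ.iterDom 1 := (isOpen_iterDom 1).mem_nhds hx1
    have h1 : Tendsto e (𝓝 x) (𝓝 (e x)) := by
      refine tendsto_nhds (hmem hx1) ?_ ?_ (hev.mono fun y hy => hmem hy)
      · rw [he hx1]
        refine Tendsto.congr' ?_ tendsto_id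
        filter_upwards [hev] with y hy
        rw [he hy]
        rfl
      · rw [he hx1]
        refine Tendsto.congr' ?_ (continuousAt_iterate hx1)
        filter_upwards [hev] with y hy
        rw [he hy]
        rfl
    exact ((hc.tendsto _).comp h1).mono_left nhdsWithin_le_nhds
  · obtain ⟨n, m, hd, hr⟩ := g.exists_rel
    rw [cocycle_eq _ g hd hr, ← hiter n hr.1, ← hiter m hr.2.1]
    have h0 : g.src = (iterElement hr.2.1).rng := rfl
    have h1 : Gpd.mul g (iterElement hr.2.1) h0 = iterElement hr.1 :=
      Gpd.ext rfl (by simp [iterElement, Gpd.mul, hd]) hr.2.2.symm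
    rw [← h1, hmul]
    ring

end PartialLocalHomeo

theorem mainTheorem9 {X : Type*} [TopologicalSpace X] [LocallyCompactSpace X]
    [SecondCountableTopology X] [T2Space X] [MeasurableSpace X] [BorelSpace X]
    (φ : PartialLocalHomeo X) (hmin : φ.IsMinimal) (hap : ∃ x : X, φ.IsAperiodic x)
    (α : KMS.OneParameterGroup φ.ReducedCStar)
    (hKMS : ∃ β : ℝ, β ≠ 0 ∧ ∃ ψ : φ.ReducedCStar → ℝ≥0∞,
      KMS.IsKMSWeight α β ψ ∧ PartialLocalHomeo.IsDiagonal ψ) :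
    ∃ F : X → ℝ, ContinuousOn F φ.dom ∧
      ∀ (t : ℝ) (g : C_c(φ.Gpd, ℂ)), ∃ h : C_c(φ.Gpd, ℂ),
        (∀ ξ : φ.Gpd, h ξ =
          Complex.exp (Complex.I * t * PartialLocalHomeo.Gpd.cocycle F ξ) * g ξ) ∧
        α.toFun t (PartialLocalHomeo.ofCc g) = PartialLocalHomeo.ofCc h := by
  obtain ⟨β, hβ, ψ, hK, m, hm, hψ⟩ := hKMS
  obtain ⟨c, hc, hcα, hunit, hmul⟩ := PartialLocalHomeo.exists_continuous_homomorphism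
    (PartialLocalHomeo.dense_hasTrivialIsotropy hmin hap) α
    fun t f hf => PartialLocalHomeo.apply_diag_eq hmin hψ hβ hK hf t
  obtain ⟨F, hF, hcF⟩ := PartialLocalHomeo.exists_eq_cocycle hc hunit hmul
  refine ⟨F, hF, fun t g => ?_⟩
  refine ⟨⟨⟨fun ξ => Complex.exp (Complex.I * t * c ξ) * g ξ, ?_⟩, ?_⟩, fun ξ => ?_, ?_⟩
  · have := g.continuous
    fun_prop
  · exact g.hasCompactSupport.mul_left
  · rw [← hcF]
    rfl
  -- Both sides have the same coefficients, and these determine an element of the algebra.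
  · refine PartialLocalHomeo.coeff_injective (funext fun ξ => ?_)
    rw [hcα, PartialLocalHomeo.coeff_ofCc, PartialLocalHomeo.coeff_ofCc]
    rfl
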